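/- Let $D=(\mathbb R/\mathbb Z)^d$ be the flat torus, $\|\cdot\|$ the norm of $L^2(D;\mathbb R^d)$, $L^2_{\rm div}$ the closed subspace of (weakly) divergence-free fields, and $\mathbb P$ the orthogonal projector of $L^2(D;\mathbb R^d)$ onto $L^2_{\rm div}$. The magnetic relaxation equations are $$\partial_t B+\nabla\cdot(B\otimes v-v\otimes B)=0,\qquad v=\mathbb P\,\nabla\cdot(B\otimes B),\qquad \nabla\cdot B=0,$$ where $(\nabla\cdot(a\otimes b))_i=\sum_j\partial_j(a_ib_j)$. For $r\ge 0$ and $B\in L^2_{\rm div}$ set $$K_r(B)=\sup_z\Big\{\int_D\sum_{i,j}B_iB_j\,(\nabla z+\nabla z^T+rI)_{ij}\,dx-\|z\|^2\Big\}\in[0,+\infty],$$ the supremum being over all $z\in C^1(D;\mathbb R^d)$ with $\nabla\cdot z=0$ and $\nabla z+\nabla z^T+rI\ge 0$ everywhere. Let $T>0$ and $B^0\in L^2_{\rm div}$. A pair $(B,v)$ is a dissipative solution up to time $T$ with initial condition $B^0$ if: (i) $B$ is weakly continuous from $[0,T]$ to $L^2_{\rm div}$ and $B(0)=B^0$; (ii)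 $v\in L^2([0,T];L^2_{\rm div})$; (iii) $\partial_tB+\nabla\cdot(B\otimes v-v\otimes B)=0$ on $(0,T)\times D$ in the sense of distributions; (iv) for every nonnegative integrable function $r$ on $[0,T]$, with $R(t)=\int_0^tr(s)\,ds$, and for all $t\in[0,T]$, $$\|B(t)\|^2+\int_0^t\big[\|v(s)\|^2+K_{r(s)}(B(s))\big]e^{R(t)-R(s)}\,ds\le\|B(0)\|^2e^{R(t)}.$$ A smooth solution up to time $T$ is a pair $(\beta,\omega)$ of divergence-free vector fields, $C^\infty$ on $[0,T]\times D$, satisfying the magnetic relaxation equations pointwise on $[0,T]\times D$, with $\beta,\omega$ in place of $B,v$. **Theorem.** There is a function $C:[0,\infty)\to\mathbb R$ such that the following holds for every dimension $d$ and every $T>0$. Let $(B,v)$ be a dissipative solution and $(\beta,\omega)$ a smooth solution of the magnetic relaxation equations up to time $T$. If $\Lambda\ge 0$ is such that $\beta(t,\cdot)$ and $\omega(t,\cdot)$ are $\Lambda$-Lipschitz on $D$ for every $t\in[0,T]$, then, with $C=C(\Lambda)$, for all $t\in[0,T]$, $$\|(B-\beta)(t,\cdot)\|^2+\int_0^te^{C(t-s)}\,\tfrac12\|v(s,\cdot)-\omega(s,\cdot)\|^2\,ds\le\|(B-\beta)(0,\cdot)\|^2\,e^{Ct},$$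 where the integrand on the left is integrable on $[0,t]$. Consequently, smooth solutions are unique among dissipative solutions with the same initial condition: if $B(0,\cdot)=\beta(0,\cdot)$, then $B(t,\cdot)=\beta(t,\cdot)$ for all $t\in[0,T]$ and $v(t,\cdot)=\omega(t,\cdot)$ for almost every $t\in[0,T]$. -/

import Mathlib

open MeasureTheory Set
open scoped NNReal ENNReal ContDiff InnerProductSpace

noncomputable section

namespace MRE

/-- Euclidean space of dimension `d`. -/
abbrev E (d : ℕ) : Type := EuclideanSpace ℝ (Fin d)

/-- The flat torus `(ℝ/ℤ)^d`; its `volume` is the product Haar probability measure. -/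
abbrev Torus (d : ℕ) : Type := UnitAddTorus (Fin d)

/-- The covering map `ℝ^d → (ℝ/ℤ)^d`. -/
def proj {d : ℕ} (x : E d) : Torus d := fun i => (x i : UnitAddCircle)

/-- A function on the torus is of class `C^n` if its periodic lift to `ℝ^d` is. -/
def IsCk {d : ℕ} {F : Type*} [NormedAddCommGroup F] [NormedSpace ℝ F]
    (n : WithTop ℕ∞) (f : Torus d → F) : Prop :=
  ContDiff ℝ n (fun x : E d => f (proj x))

/-- The partial derivative `∂_i f (x)` of a function on the torus. -/
def pd {d : ℕ} {F : Type*} [NormedAddCommGroup F] [NormedSpace ℝ F]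
    (i : Fin d) (f : Torus d → F) (x : Torus d) : F :=
  deriv (fun h : ℝ => f (x + Pi.single i (h : UnitAddCircle))) 0

/-- The gradient of a scalar function. -/
def grad {d : ℕ} (f : Torus d → ℝ) (x : Torus d) : E d :=
  WithLp.toLp 2 (fun i => pd i f x)

/-- The divergence `∑_i ∂_i z_i` of a vector field. -/
def div {d : ℕ} (z : Torus d → E d) (x : Torus d) : ℝ :=
  ∑ i, pd i (fun y => z y i) x

/-- The divergence `∑_j ∂_j (a_i b_j)` of the tensor field `a ⊗ b`. -/
def divTensor {d : ℕ} (a b : Torus d → E d) (x : Torus d) : E d :=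
  WithLp.toLp 2 (fun i => ∑ j, pd j (fun y => a y i * b y j) x)

/-- The matrix `∇z + ∇zᵀ` at `x`. -/
def symGrad {d : ℕ} (z : Torus d → E d) (x : Torus d) : Matrix (Fin d) (Fin d) ℝ :=
  Matrix.of fun i j => pd i (fun y => z y j) x + pd j (fun y => z y i) x

/-- The Hilbert space of `L²` vector fields on the torus. -/
abbrev L2 (d : ℕ) : Type := Lp (E d) 2 (volume : Measure (Torus d))

open Classical in
/-- The `L²` class of a vector field; it is only used for continuous fields, which are all
square-integrable (the value `0` for the other fields plays no role). -/
def toL2 {d : ℕ} (f : Torus d → E d) : L2 d :=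
  if h : MemLp f 2 (volume : Measure (Torus d)) then h.toLp f else 0

/-- The closed subspace of divergence-free `L²` fields (in the weak sense): those that are
`L²`-orthogonal to the gradients of all smooth functions. -/
def L2Div (d : ℕ) : Submodule ℝ (L2 d) :=
  (Submodule.span ℝ {g : L2 d | ∃ f : Torus d → ℝ, IsCk ∞ f ∧ g = toL2 (grad f)})ᗮ

/-- The Helmholtz-Leray projector: the orthogonal projector of `L²` onto the divergence-free
fields. -/
def leray (d : ℕ) : L2 d →L[ℝ] L2Div d :=
  (Submodule.span ℝ {g : L2 d | ∃ f : Torus d → ℝ, IsCk ∞ f ∧ g = toL2 (grad f)})ᗮ.orthogonalProjectionOnto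

/-- The functional `K_r(B)`, the supremum of
`∫ (B ⊗ B) : (∇z + ∇zᵀ + r I) dx - ‖z‖²` over the `C¹` divergence-free fields `z` with
`∇z + ∇zᵀ + r I ≥ 0`. For `r ≥ 0` the field `z = 0` gives the value `r ‖B‖² ≥ 0`, so
truncating the competitors at `0` does not change the supremum. -/
def K {d : ℕ} (r : ℝ) (B : L2 d) : ℝ≥0∞ :=
  ⨆ (z : Torus d → E d) (_ : IsCk 1 z) (_ : ∀ x, div z x = 0)
    (_ : ∀ x, (symGrad z x + r • (1 : Matrix (Fin d) (Fin d) ℝ)).PosSemidef),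
    ENNReal.ofReal
      ((∫ x, ∑ i, ∑ j, B x i * B x j * (symGrad z x + r • (1 : Matrix (Fin d) (Fin d) ℝ)) i j)
        - ∫ x, ‖z x‖ ^ 2)

/-- Smooth vector-valued test functions with compact support in `(0,T) × D`. -/
structure IsTest {d : ℕ} (T : ℝ) (φ : ℝ → Torus d → E d) : Prop where
  smooth : ContDiff ℝ ∞ (fun p : ℝ × E d => φ p.1 (proj p.2))
  support : ∃ a b : ℝ, 0 < a ∧ b < T ∧ ∀ t, t ∉ Icc a b → ∀ x, φ t x = 0

/-- The transport equation `∂_t B + ∇ · (B ⊗ v - v ⊗ B) = 0` on `(0,T) × D` in the sense of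
distributions. -/
def IsTransported {d : ℕ} (T : ℝ) (B v : ℝ → L2 d) : Prop :=
  ∀ φ : ℝ → Torus d → E d, IsTest T φ →
    ∫ t in (0 : ℝ)..T, ∫ x,
      ((∑ i, B t x i * deriv (fun s => φ s x i) t)
        + ∑ i, ∑ j, (B t x i * v t x j - v t x i * B t x j) * pd j (fun y => φ t y i) x) = 0

/-- `(B, v)` is a dissipative solution of the magnetic relaxation equations up to time `T` with
initial condition `B₀`. -/
structure IsDissipativeSolution {d : ℕ} (T : ℝ) (B₀ : L2Div d) (B v : ℝ → L2Div d) : Prop where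
  /-- `B` is weakly continuous on `[0,T]` with values in the divergence-free fields. -/
  weak_cont : ∀ ψ : L2Div d, ContinuousOn (fun t => ⟪ψ, B t⟫_ℝ) (Icc 0 T)
  initial : B 0 = B₀
  /-- `v` is square-integrable in time with values in the divergence-free fields. -/
  sq_integrable : MemLp v 2 (volume.restrict (Icc 0 T))
  transport : IsTransported T (fun t => (B t : L2 d)) (fun t => (v t : L2 d))
  /-- The dissipation inequality, for every nonnegative integrable function `r` of time, with
  `R(t) = ∫₀ᵗ r`. -/
  dissipation : ∀ r : ℝ → ℝ, (∀ t ∈ Icc 0 T, 0 ≤ r t) → IntervalIntegrable r volume 0 T →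
    ∀ t ∈ Icc 0 T,
      ENNReal.ofReal (‖B t‖ ^ 2)
        + ∫⁻ s in Icc 0 t, (ENNReal.ofReal (‖v s‖ ^ 2) + K (r s) (B s : L2 d))
            * ENNReal.ofReal (Real.exp ((∫ τ in (0 : ℝ)..t, r τ) - ∫ τ in (0 : ℝ)..s, r τ))
      ≤ ENNReal.ofReal (‖B 0‖ ^ 2 * Real.exp (∫ τ in (0 : ℝ)..t, r τ))

/-- `(β, w)` is a smooth solution on `[0,T] × D` of
`∂_t β + ∇ · (β ⊗ w - w ⊗ β) = 0`, `w = ℙ ∇ · (β ⊗ β)`, `∇ · β = ∇ · w = 0`. -/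
structure IsSmoothSolution {d : ℕ} (T : ℝ) (β w : ℝ → Torus d → E d) : Prop where
  smooth_β : ContDiffOn ℝ ∞ (fun p : ℝ × E d => β p.1 (proj p.2)) (Icc 0 T ×ˢ univ)
  smooth_w : ContDiffOn ℝ ∞ (fun p : ℝ × E d => w p.1 (proj p.2)) (Icc 0 T ×ˢ univ)
  div_β : ∀ t ∈ Icc 0 T, ∀ x, div (β t) x = 0
  div_w : ∀ t ∈ Icc 0 T, ∀ x, div (w t) x = 0
  transport : ∀ t ∈ Icc 0 T, ∀ x, HasDerivWithinAt (fun s => β s x)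
    (-(divTensor (β t) (w t) x - divTensor (w t) (β t) x)) (Icc 0 T) t
  velocity : ∀ t ∈ Icc 0 T, toL2 (w t) = leray d (toL2 (divTensor (β t) (β t)))

/-- `Λ` is a spatial Lipschitz constant on `[0,T]` of the time-dependent field `f`. -/
def SpatiallyLipschitz {d : ℕ} (T : ℝ) (Λ : ℝ≥0) (f : ℝ → Torus d → E d) : Prop :=
  ∀ t ∈ Icc 0 T, LipschitzWith Λ (fun x : E d => f t (proj x))

end MRE

end

noncomputable section

namespace MRE

/-! ### Weak derivatives in one real variable -/

variable {d : ℕ} {T : ℝ}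

/-! The proof is a relative energy estimate. Expand `‖B - β‖² = ‖B‖² + f` with `f = ‖β‖² - 2⟪B, β⟫`.
The first term is only controlled through the dissipation inequality, but `f` is absolutely
continuous: `β` is smooth, and the transport equation for `B`, tested with `χ(t) β`, gives the weak
derivative of `⟪B, β⟫`. Put `g = f'`.

Take the constant `r = 2L + 8L²` in the dissipation inequality, where `L` is the common Lipschitz
constant, and bound `K_r(B)` below by its value at the competitor `z = -w`, admissible because `2L ≤
r` (`ofReal_le_K`). The heart of the matter is then, at each time, `½‖v - w‖² + g - r f ≤ ‖v‖² +
K_r(B)`, proved in `half_norm_sub_sq_le`: after adding four integrals that vanish (two from `w =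
ℙ∇·(β ⊗ β)`, two from the fact that `B` and `v` are orthogonal to gradients), everything cancels
except terms quadratic in `(B - β, v - w)`, which `r‖B - β‖²` and `½‖v - w‖²` absorb.

Multiplying by `e^{r(t-s)}` and integrating, `g - r f` becomes `f(t) - e^{rt} f(0)`, and the
dissipation inequality turns into the claim. The Gronwall factor is thus already contained in the
definition of dissipative solution, and `‖B‖²` is never differentiated. -/

/-- A continuous function whose distributional derivative is integrable is its integral. -/
lemma sub_eq_integral_of_weak_deriv (hT : 0 < T) {F G : ℝ → ℝ}
    (hF : ContinuousOn F (Icc 0 T)) (hG : IntervalIntegrable G volume 0 T)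
    (h : ∀ χ : ℝ → ℝ, ContDiff ℝ ∞ χ → (∃ a b, 0 < a ∧ b < T ∧ ∀ t ∉ Icc a b, χ t = 0) →
      ∫ t in (0 : ℝ)..T, (deriv χ t * F t + χ t * G t) = 0) :
    ∀ t ∈ Icc 0 T, F t - F 0 = ∫ s in (0 : ℝ)..t, G s := by
  have huI : uIcc 0 T = Icc 0 T := uIcc_of_le hT.le
  have h0mem : (0 : ℝ) ∈ uIcc 0 T := left_mem_uIcc
  set H : ℝ → ℝ := fun t => ∫ s in (0 : ℝ)..t, G s with hH
  have hHac : AbsolutelyContinuousOnInterval H 0 T :=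
    hG.absolutelyContinuousOnInterval_intervalIntegral h0mem
  have hHc : ContinuousOn H (Icc 0 T) := huI ▸ hHac.continuousOn
  have hPc : ContinuousOn (fun t => F t - H t) (Icc 0 T) := hF.sub hHc
  -- Integration by parts against the primitive `H` of `G`: `F - H` has zero weak derivative, hence
  -- should be constant.
  have h1 : ∀ χ : ℝ → ℝ, ContDiff ℝ ∞ χ → (∃ a b, 0 < a ∧ b < T ∧ ∀ t ∉ Icc a b, χ t = 0) →
      ∫ t in (0 : ℝ)..T, deriv χ t * (F t - H t) = 0 := by
    intro χ hχ hs
    have h2 := h χ hχ hs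
    obtain ⟨a, b, ha, hb, hab⟩ := hs
    have hχ0 : χ 0 = 0 := hab 0 fun h => absurd h.1 (not_le.2 ha)
    have hχT : χ T = 0 := hab T fun h => absurd h.2 (not_le.2 hb)
    have hχ1 : ContDiff ℝ 1 χ := hχ.of_le (by simp)
    have hχac : AbsolutelyContinuousOnInterval χ 0 T :=
      hχ1.contDiffOn.absolutelyContinuousOnInterval
    have hibp := hχac.integral_mul_deriv_eq_deriv_mul hHac
    have hder : ∫ t in (0 : ℝ)..T, χ t * deriv H t = ∫ t in (0 : ℝ)..T, χ t * G t := by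
      refine intervalIntegral.integral_congr_ae ?_
      filter_upwards [hG.ae_hasDerivAt_integral] with t ht htm
      rw [(ht (uIoc_subset_uIcc htm) 0 h0mem).deriv]
    rw [hder, hχ0, hχT, zero_mul, zero_mul, sub_zero, zero_sub] at hibp
    have hdc : Continuous (deriv χ) := hχ1.continuous_deriv le_rfl
    have i1 : IntervalIntegrable (fun t => deriv χ t * F t) volume 0 T :=
      (hdc.continuousOn.mul (huI ▸ hF)).intervalIntegrable
    have i2 : IntervalIntegrable (fun t => χ t * G t) volume 0 T :=
      hG.continuousOn_mul hχ.continuous.continuousOn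
    have i3 : IntervalIntegrable (fun t => deriv χ t * H t) volume 0 T :=
      (hdc.continuousOn.mul (huI ▸ hHc)).intervalIntegrable
    rw [intervalIntegral.integral_add i1 i2] at h2
    simp only [mul_sub]
    rw [intervalIntegral.integral_sub i1 i3]
    linarith
  let f : ContDiffBump (T / 2) := ⟨T / 8, T / 4, by positivity, by linarith⟩
  set η₀ : ℝ → ℝ := f.normed volume with hη₀
  have hη₀s : ContDiff ℝ ∞ η₀ := f.contDiff_normed
  have hη₀t : tsupport η₀ ⊆ Ioo 0 T := by
    rw [hη₀, f.tsupport_normed_eq, Real.closedBall_eq_Icc]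
    intro t ht
    have := ht.1
    have := ht.2
    simp only [f] at *
    constructor <;> linarith
  have integral_eq : ∀ g : ℝ → ℝ, (∀ t ∉ Ioo 0 T, g t = 0) → ∫ t, g t = ∫ t in (0 : ℝ)..T, g t := by
    intro g hg
    rw [intervalIntegral.integral_of_le hT.le, setIntegral_eq_integral_of_forall_compl_eq_zero]
    exact fun t ht => hg t fun h => ht ⟨h.1, h.2.le⟩
  have vanish : ∀ g : ℝ → ℝ, tsupport g ⊆ Ioo 0 T → ∀ t ∉ Ioo 0 T, g t = 0 := fun g hg t ht =>
    image_eq_zero_of_notMem_tsupport fun h => ht (hg h)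
  have hη₀i : ∫ t in (0 : ℝ)..T, η₀ t = 1 := by
    rw [← integral_eq _ (vanish _ hη₀t)]; exact f.integral_normed
  set k : ℝ := ∫ t in (0 : ℝ)..T, η₀ t * (F t - H t) with hk
  have h2 : ∀ᵐ t, t ∈ Ioo 0 T → F t - H t - k = 0 := by
    refine isOpen_Ioo.ae_eq_zero_of_integral_contDiff_smul_eq_zero ?_ fun η hη hηc hηt => ?_
    · exact ((hPc.sub continuousOn_const).mono Ioo_subset_Icc_self).locallyIntegrableOn
        measurableSet_Ioo
    -- Du Bois-Reymond: `η` minus its mean times the normalized bump `η₀` has integral zero, so its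
    -- primitive is compactly supported and may serve as `χ` in `h1`.
    · set c : ℝ := ∫ t in (0 : ℝ)..T, η t with hc
      set g : ℝ → ℝ := fun t => η t - c * η₀ t with hg
      have hgs : ContDiff ℝ ∞ g := hη.sub (contDiff_const.mul hη₀s)
      have hgi : ∫ t in (0 : ℝ)..T, g t = 0 := by
        simp only [hg]
        rw [intervalIntegral.integral_sub (hη.continuous.intervalIntegrable _ _)
          ((hη₀s.continuous.intervalIntegrable _ _).const_mul c),
          intervalIntegral.integral_const_mul, hη₀i, ← hc]
        ring
      set χ : ℝ → ℝ := fun t => ∫ s in (0 : ℝ)..t, g s with hχ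
      have hχd : ∀ t, HasDerivAt χ (g t) t := fun t =>
        intervalIntegral.integral_hasDerivAt_right (hgs.continuous.intervalIntegrable _ _)
          (hgs.continuous.stronglyMeasurableAtFilter _ _) hgs.continuous.continuousAt
      have hχd' : deriv χ = g := funext fun t => (hχd t).deriv
      have hχs : ContDiff ℝ ∞ χ :=
        contDiff_infty_iff_deriv.2 ⟨fun t => (hχd t).differentiableAt, hχd' ▸ hgs⟩
      obtain ⟨a, b, ha, hb, hab⟩ : ∃ a b, 0 < a ∧ b < T ∧ ∀ t ∉ Icc a b, g t = 0 := by
        have hcomp : IsCompact (tsupport η ∪ tsupport η₀) := hηc.isCompact.union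
          f.hasCompactSupport_normed.isCompact
        have hsub : tsupport η ∪ tsupport η₀ ⊆ Ioo 0 T := union_subset hηt hη₀t
        have hne : (tsupport η ∪ tsupport η₀).Nonempty := by
          refine ⟨T / 2, Or.inr ?_⟩
          rw [hη₀, f.tsupport_normed_eq]
          exact Metric.mem_closedBall_self f.rOut_pos.le
        refine ⟨sInf (tsupport η ∪ tsupport η₀), sSup (tsupport η ∪ tsupport η₀),
          (hsub (hcomp.sInf_mem hne)).1, (hsub (hcomp.sSup_mem hne)).2, fun t ht => ?_⟩
        have : t ∉ tsupport η ∪ tsupport η₀ := fun h =>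
          ht ⟨csInf_le hcomp.bddBelow h, le_csSup hcomp.bddAbove h⟩
        simp only [mem_union, not_or] at this
        simp [hg, image_eq_zero_of_notMem_tsupport this.1,
          image_eq_zero_of_notMem_tsupport this.2]
      have hχz : ∀ t ∉ Icc a b, χ t = 0 := by
        intro t ht
        rcases lt_or_ge t a with h | h
        · refine intervalIntegral.integral_zero_ae (.of_forall fun s hs => hab s fun h' => ?_)
          have : s ≤ max 0 t := hs.2
          exact absurd (h'.1.trans this) (not_le.2 (max_lt ha h))
        · have hbt : b < t := not_le.1 fun h' => ht ⟨h, h'⟩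
          have h3 : ∫ s in t..T, g s = 0 := by
            refine intervalIntegral.integral_zero_ae (.of_forall fun s hs => hab s fun h' => ?_)
            have : min t T < s := hs.1
            exact absurd (this.trans_le h'.2) (not_lt.2 (le_min hbt.le hb.le))
          have h4 := intervalIntegral.integral_add_adjacent_intervals
            (hgs.continuous.intervalIntegrable (μ := volume) 0 t)
            (hgs.continuous.intervalIntegrable t T)
          rw [h3, hgi, add_zero] at h4
          exact h4
      have h5 := h1 χ hχs ⟨a, b, ha, hb, hχz⟩
      rw [hχd'] at h5
      have iP : ∀ u : ℝ → ℝ, Continuous u →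
          IntervalIntegrable (fun t => u t * (F t - H t)) volume 0 T := fun u hu =>
        (hu.continuousOn.mul (huI ▸ hPc)).intervalIntegrable
      have h6 : ∫ t in (0 : ℝ)..T, g t * (F t - H t) =
          (∫ t in (0 : ℝ)..T, η t * (F t - H t)) - c * k := by
        rw [hk, ← intervalIntegral.integral_const_mul,
          ← intervalIntegral.integral_sub (iP _ hη.continuous) ((iP _ hη₀s.continuous).const_mul c)]
        refine intervalIntegral.integral_congr fun t _ => ?_
        simp only [hg]; ring
      rw [integral_eq _ fun t ht => by simp [vanish η hηt t ht]]
      simp only [smul_eq_mul, mul_sub (η _) (F _ - H _) k]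
      rw [intervalIntegral.integral_sub (iP _ hη.continuous)
        ((hη.continuous.intervalIntegrable _ _).mul_const k),
        intervalIntegral.integral_mul_const, ← hc]
      linarith
  -- Continuity upgrades the almost everywhere identity to all of `[0, T]`, endpoints included.
  have h3 : EqOn (fun t => F t - H t) (fun _ => k) (Icc 0 T) := by
    refine Measure.eqOn_Icc_of_ae_eq volume hT.ne ?_ hPc continuousOn_const
    rw [← restrict_Ioo_eq_restrict_Icc, Filter.EventuallyEq, ae_restrict_iff' measurableSet_Ioo]
    filter_upwards [h2] with t ht htm
    linarith [ht htm]
  intro t ht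
  have e1 := h3 ht
  have e2 := h3 (left_mem_Icc.2 hT.le)
  have e3 : H 0 = 0 := intervalIntegral.integral_same
  simp only at e1 e2
  rw [e3] at e2
  have e4 : H t = ∫ s in (0 : ℝ)..t, G s := rfl
  linarith

/-! ### Calculus on the torus through the periodic lift -/

/-- Open quotient maps, unlike general quotient maps, are stable under products; this lets
continuity descend to the torus also in the presence of a time parameter. -/
lemma isOpenQuotientMap_proj : IsOpenQuotientMap (proj : E d → Torus d) := by
  have h1 : IsOpenQuotientMap (Pi.map (fun (_ : Fin d) (x : ℝ) => (x : UnitAddCircle))) :=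
    IsOpenQuotientMap.piMap fun _ => QuotientAddGroup.isOpenQuotientMap_mk
  exact h1.comp (EuclideanSpace.equiv (Fin d) ℝ).toHomeomorph.isOpenQuotientMap

lemma proj_surjective : Function.Surjective (proj : E d → Torus d) :=
  isOpenQuotientMap_proj.surjective

lemma proj_add (x y : E d) : proj (x + y) = proj x + proj y := by
  ext i; simp [proj]

lemma proj_smul_single (h : ℝ) (i : Fin d) :
    proj (h • EuclideanSpace.single i (1 : ℝ)) = Pi.single i (h : UnitAddCircle) := by
  ext j
  by_cases hij : j = i
  · subst hij; simp [proj]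
  · simp [proj, hij]

lemma continuous_of_lift {X : Type*} [TopologicalSpace X] {f : Torus d → X}
    (h : Continuous fun y : E d => f (proj y)) : Continuous f :=
  isOpenQuotientMap_proj.isQuotientMap.continuous_iff.2 h

lemma continuous_uncurry_of_lift {X S : Type*} [TopologicalSpace X] [TopologicalSpace S]
    {f : S → Torus d → X} (h : Continuous fun p : S × E d => f p.1 (proj p.2)) :
    Continuous fun p : S × Torus d => f p.1 p.2 :=
  ((IsOpenQuotientMap.id (X := S)).prodMap
    (isOpenQuotientMap_proj (d := d))).isQuotientMap.continuous_iff.2 h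

lemma pd_proj {F : Type*} [NormedAddCommGroup F] [NormedSpace ℝ F] {f : Torus d → F} {y : E d}
    (hf : DifferentiableAt ℝ (fun x => f (proj x)) y) (i : Fin d) :
    pd i f (proj y) = fderiv ℝ (fun x => f (proj x)) y (EuclideanSpace.single i 1) := by
  have h1 : HasDerivAt (fun h : ℝ => y + h • EuclideanSpace.single i (1 : ℝ))
      (EuclideanSpace.single i (1 : ℝ)) 0 := by
    simpa using ((hasDerivAt_id (0 : ℝ)).smul_const (EuclideanSpace.single i (1 : ℝ))).const_add y
  have h2 := HasFDerivAt.comp_hasDerivAt_of_eq (0 : ℝ) hf.hasFDerivAt h1 (by simp)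
  rw [← h2.deriv]
  simp only [pd, Function.comp_def, proj_add, proj_smul_single]

/-- A preimage of a point of the torus under the covering map. -/
def lift (x : Torus d) : E d := Function.surjInv proj_surjective x

lemma proj_lift (x : Torus d) : proj (lift x) = x := Function.surjInv_eq _ x

/-- The differential of a vector field on the torus. -/
def jac (z : Torus d → E d) (x : Torus d) : E d →L[ℝ] E d :=
  fderiv ℝ (fun y => z (proj y)) (lift x)

/-- The lift is periodic, hence so is its differential; this makes `jac` independent of the
arbitrary choice in `lift`. -/
lemma fderiv_eq_of_proj_eq {F : Type*} [NormedAddCommGroup F] [NormedSpace ℝ F]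
    (f : Torus d → F) {y y' : E d} (h : proj y = proj y') :
    fderiv ℝ (fun x => f (proj x)) y = fderiv ℝ (fun x => f (proj x)) y' := by
  have h0 : proj (y - y') = 0 := by
    have : proj (y - y') + proj y' = proj y := by rw [← proj_add, sub_add_cancel]
    rw [h] at this; simpa using this
  have := fderiv_comp_add_right (𝕜 := ℝ) (f := fun x => f (proj x)) (x := y') (y - y')
  simp only [proj_add, h0, add_zero] at this
  rw [this]; congr 1; abel

lemma jac_proj (z : Torus d → E d) (y : E d) :
    jac z (proj y) = fderiv ℝ (fun y => z (proj y)) y :=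
  fderiv_eq_of_proj_eq z (proj_lift _)

lemma continuous_of_isCk {F : Type*} [NormedAddCommGroup F] [NormedSpace ℝ F] {f : Torus d → F}
    {n : WithTop ℕ∞} (hf : IsCk n f) : Continuous f :=
  continuous_of_lift (ContDiff.continuous hf)

lemma continuous_jac {z : Torus d → E d} (hz : IsCk 1 z) : Continuous (jac z) := by
  refine continuous_of_lift ?_
  simp only [jac_proj]
  exact ContDiff.continuous_fderiv hz one_ne_zero

lemma norm_jac_le {z : Torus d → E d} {L : ℝ≥0} (hz : LipschitzWith L fun y => z (proj y))
    (x : Torus d) : ‖jac z x‖ ≤ L :=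
  norm_fderiv_le_of_lipschitz ℝ hz

lemma differentiable_lift {F : Type*} [NormedAddCommGroup F] [NormedSpace ℝ F] {f : Torus d → F}
    (hf : IsCk 1 f) : Differentiable ℝ fun y : E d => f (proj y) :=
  ContDiff.differentiable hf one_ne_zero

lemma differentiable_lift_apply {z : Torus d → E d} (hz : IsCk 1 z) (i : Fin d) :
    Differentiable ℝ fun y : E d => z (proj y) i :=
  (EuclideanSpace.proj i : E d →L[ℝ] ℝ).differentiable.comp (differentiable_lift hz)

lemma pd_apply {z : Torus d → E d} (hz : IsCk 1 z) (i j : Fin d) (x : Torus d) :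
    pd j (fun y => z y i) x = jac z x (EuclideanSpace.single j 1) i := by
  obtain ⟨y, rfl⟩ := proj_surjective x
  rw [jac_proj, pd_proj (differentiable_lift_apply hz i y)]
  have h := (EuclideanSpace.proj i : E d →L[ℝ] ℝ).hasFDerivAt.comp y
    (differentiable_lift hz y).hasFDerivAt
  rw [show fderiv ℝ (fun x => z (proj x) i) y = _ from h.fderiv]
  rfl

lemma clm_apply_eq_sum (A : E d →L[ℝ] E d) (a : E d) (i : Fin d) :
    A a i = ∑ j, A (EuclideanSpace.single j 1) i * a j := by
  have ha : a = ∑ j, a j • EuclideanSpace.single j (1 : ℝ) := by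
    ext k; simp [Finset.sum_apply, Pi.single_apply]
  conv_lhs => rw [ha]
  simp [map_sum, mul_comm]

lemma sum_pd_mul {z : Torus d → E d} (hz : IsCk 1 z) (a : E d) (i : Fin d) (x : Torus d) :
    ∑ j, pd j (fun y => z y i) x * a j = jac z x a i := by
  rw [clm_apply_eq_sum]; simp only [pd_apply hz]

lemma pd_mul {f g : Torus d → ℝ} {x : Torus d}
    (hf : Differentiable ℝ fun y : E d => f (proj y))
    (hg : Differentiable ℝ fun y : E d => g (proj y)) (j : Fin d) :
    pd j (fun y => f y * g y) x = pd j f x * g x + f x * pd j g x := by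
  obtain ⟨y, rfl⟩ := proj_surjective x
  rw [pd_proj (hf y), pd_proj (hg y), pd_proj ((hf y).mul (hg y)), fderiv_fun_mul (hf y) (hg y)]
  simp; ring

/-- For a divergence-free field `b`, `∇ · (a ⊗ b) = (b · ∇) a`. -/
lemma divTensor_eq {a b : Torus d → E d} (ha : IsCk 1 a) (hb : IsCk 1 b)
    (hdiv : ∀ x, div b x = 0) (x : Torus d) : divTensor a b x = jac a x (b x) := by
  ext i
  simp only [divTensor]
  rw [← sum_pd_mul ha]
  calc ∑ j, pd j (fun y => a y i * b y j) x
      = ∑ j, (pd j (fun y => a y i) x * b x j + a x i * pd j (fun y => b y j) x) :=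
        Finset.sum_congr rfl fun j _ => pd_mul (differentiable_lift_apply ha i)
          (differentiable_lift_apply hb j) j
    _ = _ := by
        rw [Finset.sum_add_distrib, ← Finset.mul_sum]
        have := hdiv x
        rw [div] at this
        rw [this, mul_zero, add_zero]

lemma inner_eq_sum (a b : E d) : ⟪a, b⟫_ℝ = ∑ i, a i * b i := by
  simp [PiLp.inner_apply, mul_comm]

lemma inner_jac_eq_sum {z : Torus d → E d} (hz : IsCk 1 z) (a b : E d) (x : Torus d) :
    ⟪a, jac z x b⟫_ℝ = ∑ i, ∑ j, a i * b j * pd j (fun y => z y i) x := by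
  rw [inner_eq_sum]
  refine Finset.sum_congr rfl fun i _ => ?_
  rw [← sum_pd_mul hz, Finset.mul_sum]
  exact Finset.sum_congr rfl fun j _ => by ring

lemma inner_grad_inner {a b : Torus d → E d} (ha : IsCk 1 a) (hb : IsCk 1 b) (c : E d)
    (x : Torus d) : ⟪c, grad (fun y => ⟪a y, b y⟫_ℝ) x⟫_ℝ =
      ⟪b x, jac a x c⟫_ℝ + ⟪a x, jac b x c⟫_ℝ := by
  obtain ⟨y, rfl⟩ := proj_surjective x
  have hda := differentiable_lift ha y
  have hdb := differentiable_lift hb y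
  have hd := hda.inner ℝ hdb
  have key : ∀ i, pd i (fun y => ⟪a y, b y⟫_ℝ) (proj y) =
      ⟪a (proj y), jac b (proj y) (EuclideanSpace.single i 1)⟫_ℝ +
      ⟪jac a (proj y) (EuclideanSpace.single i 1), b (proj y)⟫_ℝ := fun i => by
    rw [pd_proj hd, fderiv_inner_apply ℝ hda hdb, jac_proj, jac_proj]
  have hc : c = ∑ j, c j • EuclideanSpace.single j (1 : ℝ) := by
    ext k; simp [Finset.sum_apply, Pi.single_apply]
  rw [inner_eq_sum]
  simp only [grad, key]
  conv_rhs => rw [hc]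
  simp only [map_sum, map_smul, inner_sum, inner_smul_right]
  rw [← Finset.sum_add_distrib]
  refine Finset.sum_congr rfl fun i _ => ?_
  rw [real_inner_comm (b (proj y))]; ring

/-! ### Pairings in `L²` -/

lemma memLp_of_continuous {F : Type*} [NormedAddCommGroup F] {f : Torus d → F}
    (hf : Continuous f) [SecondCountableTopology F] :
    MemLp f 2 (volume : Measure (Torus d)) :=
  hf.memLp_of_hasCompactSupport (HasCompactSupport.of_compactSpace f)

lemma toL2_coeFn {f : Torus d → E d} (hf : Continuous f) :
    (toL2 f : Torus d → E d) =ᵐ[volume] f := by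
  rw [toL2, dif_pos (memLp_of_continuous hf)]
  exact MemLp.coeFn_toLp _

lemma memLp_clm_of_bound {α H : Type*} [MeasurableSpace α] {μ : Measure α}
    [NormedAddCommGroup H] [NormedSpace ℝ H] {A : α → H →L[ℝ] H} (hA : AEStronglyMeasurable A μ)
    {c : ℝ} (hc : ∀ᵐ x ∂μ, ‖A x‖ ≤ c) {V : α → H} (hV : MemLp V 2 μ) :
    MemLp (fun x => A x (V x)) 2 μ :=
  hV.of_le_mul (isBoundedBilinearMap_apply.continuous.comp_aestronglyMeasurable₂ hA hV.1)
    (hc.mono fun x hx => (A x).le_of_opNorm_le hx _)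

lemma memLp_clm {A : Torus d → E d →L[ℝ] E d} (hA : Continuous A) {V : Torus d → E d}
    (hV : MemLp V 2 (volume : Measure (Torus d))) :
    MemLp (fun x => A x (V x)) 2 (volume : Measure (Torus d)) := by
  obtain ⟨c, hc⟩ := isCompact_univ.exists_bound_of_continuousOn hA.continuousOn
  exact memLp_clm_of_bound hA.aestronglyMeasurable (.of_forall fun x => hc x trivial) hV

lemma integrable_inner {α H : Type*} [MeasurableSpace α] {μ : Measure α}
    [NormedAddCommGroup H] [InnerProductSpace ℝ H] {U V : α → H} (hU : MemLp U 2 μ)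
    (hV : MemLp V 2 μ) : Integrable (fun x => ⟪U x, V x⟫_ℝ) μ := by
  refine (L2.integrable_inner (𝕜 := ℝ) (hU.toLp U) (hV.toLp V)).congr ?_
  filter_upwards [hU.coeFn_toLp, hV.coeFn_toLp] with x h1 h2
  rw [h1, h2]

lemma integrable_norm_sq {α H : Type*} [MeasurableSpace α] {μ : Measure α}
    [NormedAddCommGroup H] [InnerProductSpace ℝ H] {U : α → H} (hU : MemLp U 2 μ) :
    Integrable (fun x => ‖U x‖ ^ 2) μ := by
  simpa only [real_inner_self_eq_norm_sq] using integrable_inner hU hU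

lemma norm_sq_eq_integral (B : L2 d) : ‖B‖ ^ 2 = ∫ x, ‖B x‖ ^ 2 := by
  rw [← real_inner_self_eq_norm_sq, L2.inner_def]
  simp only [real_inner_self_eq_norm_sq]

lemma inner_toL2 (B : L2 d) {f : Torus d → E d} (hf : Continuous f) :
    ⟪B, toL2 f⟫_ℝ = ∫ x, ⟪B x, f x⟫_ℝ := by
  rw [L2.inner_def]
  exact integral_congr_ae ((toL2_coeFn hf).mono fun x hx => by simp only [hx])

lemma toL2_inner_toL2 {f g : Torus d → E d} (hf : Continuous f) (hg : Continuous g) :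
    ⟪toL2 f, toL2 g⟫_ℝ = ∫ x, ⟪f x, g x⟫_ℝ := by
  rw [inner_toL2 _ hg]
  exact integral_congr_ae ((toL2_coeFn hf).mono fun x hx => by simp only [hx])

lemma norm_sub_toL2_sq (B : L2 d) {f : Torus d → E d} (hf : Continuous f) :
    ‖B - toL2 f‖ ^ 2 = ∫ x, ‖B x - f x‖ ^ 2 := by
  rw [norm_sq_eq_integral]
  refine integral_congr_ae ?_
  filter_upwards [toL2_coeFn hf, Lp.coeFn_sub B (toL2 f)] with x h1 h2
  rw [h2, Pi.sub_apply, h1]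

lemma inner_leray (v : L2Div d) (y : L2 d) : ⟪v, leray d y⟫_ℝ = ⟪(v : L2 d), y⟫_ℝ :=
  Submodule.inner_orthogonalProjectionOnto_eq_of_mem_left (K := (Submodule.span ℝ
    {g : L2 d | ∃ f : Torus d → ℝ, IsCk ∞ f ∧ g = toL2 (grad f)})ᗮ) v y

lemma integral_inner_grad {f : Torus d → ℝ} (hf : IsCk ∞ f) (hg : Continuous (grad f))
    (B : L2Div d) : ∫ x, ⟪(B : L2 d) x, grad f x⟫_ℝ = 0 := by
  rw [← inner_toL2 _ hg]
  exact (Submodule.mem_orthogonal' _ _).1 B.2 _ (Submodule.subset_span ⟨f, hf, rfl⟩)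

lemma continuous_grad_inner {a b : Torus d → E d} (ha : IsCk ∞ a) (hb : IsCk ∞ b) :
    Continuous (grad fun y => ⟪a y, b y⟫_ℝ) := by
  have h : IsCk 1 (fun y => ⟪a y, b y⟫_ℝ) :=
    (ContDiff.inner ℝ ha hb).of_le (by simp)
  refine (PiLp.continuous_toLp 2 _).comp (continuous_pi fun i => continuous_of_lift ?_)
  simp only [fun y => pd_proj (f := fun y => ⟪a y, b y⟫_ℝ) (differentiable_lift h y) i]
  exact (ContDiff.continuous_fderiv h one_ne_zero).clm_apply continuous_const

/-- The integrand is `B · ∇(a · b)`, and `B` is orthogonal to gradients. This replaces every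
integration by parts in space. -/
lemma integral_jac_inner {a b : Torus d → E d} (ha : IsCk ∞ a) (hb : IsCk ∞ b) (B : L2Div d) :
    ∫ x, (⟪b x, jac a x ((B : L2 d) x)⟫_ℝ + ⟪a x, jac b x ((B : L2 d) x)⟫_ℝ) = 0 := by
  rw [← integral_inner_grad (f := fun y => ⟪a y, b y⟫_ℝ) (ContDiff.inner ℝ ha hb)
    (continuous_grad_inner ha hb) B]
  refine integral_congr_ae (.of_forall fun x => ?_)
  exact (inner_grad_inner (ha.of_le (by simp)) (hb.of_le (by simp)) _ x).symm

/-- `f` is integrable on the torus with integral `a`. -/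
def HasIntegral (f : Torus d → ℝ) (a : ℝ) : Prop := Integrable f volume ∧ ∫ x, f x = a

lemma HasIntegral.add {f g : Torus d → ℝ} {a b : ℝ} (hf : HasIntegral f a)
    (hg : HasIntegral g b) : HasIntegral (fun x => f x + g x) (a + b) :=
  ⟨hf.1.add hg.1, by rw [integral_add hf.1 hg.1, hf.2, hg.2]⟩

lemma HasIntegral.sub {f g : Torus d → ℝ} {a b : ℝ} (hf : HasIntegral f a)
    (hg : HasIntegral g b) : HasIntegral (fun x => f x - g x) (a - b) :=
  ⟨hf.1.sub hg.1, by rw [integral_sub hf.1 hg.1, hf.2, hg.2]⟩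

lemma HasIntegral.const_mul {f : Torus d → ℝ} {a : ℝ} (hf : HasIntegral f a) (c : ℝ) :
    HasIntegral (fun x => c * f x) (c * a) :=
  ⟨hf.1.const_mul c, by rw [integral_const_mul, hf.2]⟩

lemma hasIntegral_of_integrable {f : Torus d → ℝ} (hf : Integrable f volume) :
    HasIntegral f (∫ x, f x) := ⟨hf, rfl⟩

/-! ### The spatial inequality -/

/-- Here `M`, `N` stand for `∇w`, `∇β` at a point. With `c = B - b` and `u = v - w`, the difference
of the two sides is exactly `½‖u‖² + (2L + 8L²)‖c‖² - 2⟪c, M c⟫ + 2⟪c, N u⟫ - 2⟪u, N c⟫`. The `2L`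
pays for the `M` term; the `N` terms are at most `4L‖c‖‖u‖ ≤ ½‖u‖² + 8L²‖c‖²`, which is `h5`. -/
lemma half_norm_sub_sq_le_aux {V : Type*} [NormedAddCommGroup V] [InnerProductSpace ℝ V]
    {M N : V →L[ℝ] V} {L : ℝ} (hM : ‖M‖ ≤ L) (hN : ‖N‖ ≤ L) (B v b w : V) :
    1 / 2 * ‖v - w‖ ^ 2 ≤ ‖v‖ ^ 2 - ‖w‖ ^ 2 - 2 * ⟪B, M B⟫_ℝ
      + (2 * L + 8 * L ^ 2) * ‖B - b‖ ^ 2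
      + 2 * (⟪B - b, M b - N w⟫_ℝ + (⟪B, N v⟫_ℝ - ⟪v, N B⟫_ℝ))
      - 2 * (⟪w, N b⟫_ℝ - ‖w‖ ^ 2) + 2 * (⟪v, N b⟫_ℝ - ⟪v, w⟫_ℝ)
      + 2 * (⟪w, N B⟫_ℝ + ⟪b, M B⟫_ℝ) - 2 * ⟪b, N v⟫_ℝ := by
  obtain ⟨c, rfl⟩ : ∃ c, B = c + b := ⟨B - b, by abel⟩
  obtain ⟨u, rfl⟩ : ∃ u, v = u + w := ⟨v - w, by abel⟩
  have h1 : ⟪c, M c⟫_ℝ ≤ L * ‖c‖ ^ 2 :=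
    calc ⟪c, M c⟫_ℝ ≤ ‖c‖ * ‖M c‖ := real_inner_le_norm _ _
      _ ≤ ‖c‖ * (L * ‖c‖) := by gcongr; exact M.le_of_opNorm_le hM c
      _ = _ := by ring
  have h2 : -⟪c, N u⟫_ℝ ≤ L * ‖c‖ * ‖u‖ :=
    calc -⟪c, N u⟫_ℝ ≤ ‖c‖ * ‖N u‖ := (neg_le_abs _).trans (abs_real_inner_le_norm _ _)
      _ ≤ ‖c‖ * (L * ‖u‖) := by gcongr; exact N.le_of_opNorm_le hN u
      _ = _ := by ring
  have h3 : ⟪u, N c⟫_ℝ ≤ L * ‖c‖ * ‖u‖ :=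
    calc ⟪u, N c⟫_ℝ ≤ ‖u‖ * ‖N c‖ := real_inner_le_norm _ _
      _ ≤ ‖u‖ * (L * ‖c‖) := by gcongr; exact N.le_of_opNorm_le hN c
      _ = _ := by ring
  have h4 : ‖u + w‖ ^ 2 = ‖u‖ ^ 2 + 2 * ⟪u, w⟫_ℝ + ‖w‖ ^ 2 := norm_add_sq_real u w
  have h5 := sq_nonneg (‖u‖ - 4 * L * ‖c‖)
  simp only [add_sub_cancel_right, map_add, inner_add_left, inner_add_right, inner_sub_right,
    h4, real_inner_self_eq_norm_sq]
  nlinarith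

/-- The pointwise-in-time differential inequality behind the stability estimate. -/
theorem half_norm_sub_sq_le {β w : Torus d → E d} (hβ : IsCk ∞ β) (hw : IsCk ∞ w)
    (hdβ : ∀ x, div β x = 0) {L : ℝ≥0} (hLβ : LipschitzWith L fun y : E d => β (proj y))
    (hLw : LipschitzWith L fun y : E d => w (proj y))
    (hvel : toL2 w = leray d (toL2 (divTensor β β))) (B v : L2Div d) :
    1 / 2 * ‖(v : L2 d) - toL2 w‖ ^ 2 ≤
      ‖v‖ ^ 2 + ((∫ x, (-2 * ⟪(B : L2 d) x, jac w x ((B : L2 d) x)⟫_ℝ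
          + (2 * L + 8 * L ^ 2) * ‖(B : L2 d) x‖ ^ 2)) - ∫ x, ‖w x‖ ^ 2)
      + (2 * L + 8 * L ^ 2) * (‖toL2 β‖ ^ 2 - 2 * ⟪(B : L2 d), toL2 β⟫_ℝ)
      + 2 * (⟪(B : L2 d), toL2 (fun x => jac w x (β x) - jac β x (w x))⟫_ℝ
        + ∫ x, (⟪(B : L2 d) x, jac β x ((v : L2 d) x)⟫_ℝ
          - ⟪(v : L2 d) x, jac β x ((B : L2 d) x)⟫_ℝ))
      - 2 * ⟪toL2 β, toL2 (fun x => jac w x (β x) - jac β x (w x))⟫_ℝ := by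
  have hβ1 : IsCk 1 β := hβ.of_le (by simp)
  have hw1 : IsCk 1 w := hw.of_le (by simp)
  have cβ := continuous_of_isCk hβ
  have cw := continuous_of_isCk hw
  have cN := continuous_jac hβ1
  have cM := continuous_jac hw1
  have cγ : Continuous fun x => jac w x (β x) - jac β x (w x) :=
    (cM.clm_apply cβ).sub (cN.clm_apply cw)
  have cT : Continuous fun x => jac β x (β x) := cN.clm_apply cβ
  have hT : divTensor β β = fun x => jac β x (β x) := funext (divTensor_eq hβ1 hβ1 hdβ)
  rw [hT] at hvel
  have I2 : ∀ V : L2Div d, ∫ x, (⟪(V : L2 d) x, jac β x (β x)⟫_ℝ - ⟪(V : L2 d) x, w x⟫_ℝ) = 0 := by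
    intro V
    rw [integral_sub (integrable_inner (Lp.memLp _) (memLp_of_continuous cT))
      (integrable_inner (Lp.memLp _) (memLp_of_continuous cw)), ← inner_toL2 _ cT,
      ← inner_toL2 _ cw, hvel, ← inner_leray, sub_eq_zero]
    rfl
  -- The case `V = w` of `I2`: as a projection, the class of `w` lies in `L2Div d`.
  have I1 : ∫ x, (⟪w x, jac β x (β x)⟫_ℝ - ‖w x‖ ^ 2) = 0 := by
    have := I2 (leray d (toL2 fun x => jac β x (β x)))
    rw [← hvel] at this
    rw [← this]
    refine integral_congr_ae ((toL2_coeFn cw).mono fun x hx => ?_)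
    simp only [hx, real_inner_self_eq_norm_sq]
  have I3 := integral_jac_inner hβ hw B
  have I4 := integral_jac_inner hβ hβ v
  have mB : MemLp (B : L2 d) 2 (volume : Measure (Torus d)) := Lp.memLp _
  have mv : MemLp (v : L2 d) 2 (volume : Measure (Torus d)) := Lp.memLp _
  have mβ := memLp_of_continuous cβ
  have mw := memLp_of_continuous cw
  have mγ := memLp_of_continuous cγ
  have i1 : HasIntegral (fun x => ⟪w x, jac β x (β x)⟫_ℝ - ‖w x‖ ^ 2) 0 :=
    ⟨(integrable_inner mw (memLp_of_continuous cT)).sub (integrable_norm_sq mw), I1⟩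
  have i2 : HasIntegral (fun x => ⟪(v : L2 d) x, jac β x (β x)⟫_ℝ - ⟪(v : L2 d) x, w x⟫_ℝ) 0 :=
    ⟨(integrable_inner mv (memLp_of_continuous cT)).sub (integrable_inner mv mw), I2 v⟩
  have i3 : HasIntegral (fun x => ⟪w x, jac β x ((B : L2 d) x)⟫_ℝ
      + ⟪β x, jac w x ((B : L2 d) x)⟫_ℝ) 0 :=
    ⟨(integrable_inner mw (memLp_clm cN mB)).add (integrable_inner mβ (memLp_clm cM mB)), I3⟩
  have i4 : HasIntegral (fun x => ⟪β x, jac β x ((v : L2 d) x)⟫_ℝ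
      + ⟪β x, jac β x ((v : L2 d) x)⟫_ℝ) 0 :=
    ⟨(integrable_inner mβ (memLp_clm cN mv)).add (integrable_inner mβ (memLp_clm cN mv)), I4⟩
  have iu := hasIntegral_of_integrable (integrable_norm_sq (mv.sub mw))
  have iv := hasIntegral_of_integrable (integrable_norm_sq mv)
  have iw := hasIntegral_of_integrable (integrable_norm_sq mw)
  have iβ := hasIntegral_of_integrable (integrable_norm_sq mβ)
  have iBβ := hasIntegral_of_integrable (integrable_inner mB mβ)
  have iBγ := hasIntegral_of_integrable (integrable_inner mB mγ)
  have iβγ := hasIntegral_of_integrable (integrable_inner mβ mγ)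
  have iMB : HasIntegral (fun x => -2 * ⟪(B : L2 d) x, jac w x ((B : L2 d) x)⟫_ℝ
      + (2 * L + 8 * L ^ 2) * ‖(B : L2 d) x‖ ^ 2) _ :=
    hasIntegral_of_integrable (((integrable_inner mB (memLp_clm cM mB)).const_mul _).add
      ((integrable_norm_sq mB).const_mul _))
  have iNv : HasIntegral (fun x => ⟪(B : L2 d) x, jac β x ((v : L2 d) x)⟫_ℝ
      - ⟪(v : L2 d) x, jac β x ((B : L2 d) x)⟫_ℝ) _ :=
    hasIntegral_of_integrable ((integrable_inner mB (memLp_clm cN mv)).sub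
      (integrable_inner mv (memLp_clm cN mB)))
  have nv : ‖v‖ ^ 2 = ∫ x, ‖(v : L2 d) x‖ ^ 2 := norm_sq_eq_integral (v : L2 d)
  have nβ : ‖toL2 β‖ ^ 2 = ∫ x, ‖β x‖ ^ 2 := by
    rw [← real_inner_self_eq_norm_sq, toL2_inner_toL2 cβ cβ]
    simp only [real_inner_self_eq_norm_sq]
  have hl := iu.const_mul (1 / 2)
  -- `i1` to `i4` have integral zero: they are invisible in the integrated inequality but needed for
  -- the pointwise one.
  have hr := (((((((iv.add (iMB.sub iw)).add
    ((iβ.sub (iBβ.const_mul 2)).const_mul (2 * L + 8 * L ^ 2))).add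
    ((iBγ.add iNv).const_mul 2)).sub (iβγ.const_mul 2)).sub (i1.const_mul 2)).add
    (i2.const_mul 2)).add (i3.const_mul 2)).sub i4
  have key := integral_mono hl.1 hr.1 fun x => by
    have := half_norm_sub_sq_le_aux (norm_jac_le hLw x) (norm_jac_le hLβ x)
      ((B : L2 d) x) ((v : L2 d) x) (β x) (w x)
    have hsq := norm_sub_sq_real ((B : L2 d) x) (β x)
    rw [hsq, inner_sub_left] at this
    simp only [Pi.sub_apply]
    linarith
  rw [hl.2, hr.2] at key
  rw [norm_sub_toL2_sq _ cw, inner_toL2 _ cβ, inner_toL2 _ cγ, toL2_inner_toL2 cβ cγ, nv, nβ]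
  simp only [Pi.sub_apply] at key
  linarith

/-! ### A lower bound for `K` -/

/-- A quadratic form sees only the symmetric part of its matrix, so `∇z` and its transpose
contribute equally. -/
lemma sum_mul_symGrad {z : Torus d → E d} (hz : IsCk 1 z) (r : ℝ) (a : E d) (x : Torus d) :
    ∑ i, ∑ j, a i * a j * (symGrad z x + r • (1 : Matrix (Fin d) (Fin d) ℝ)) i j =
      2 * ⟪a, jac z x a⟫_ℝ + r * ‖a‖ ^ 2 := by
  have h1 : ∑ i, ∑ j, a i * a j * pd i (fun y => z y j) x = ⟪a, jac z x a⟫_ℝ := by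
    rw [inner_jac_eq_sum hz, Finset.sum_comm]
    simp only [mul_comm]
  have h2 : ∑ i, ∑ j, a i * a j * pd j (fun y => z y i) x = ⟪a, jac z x a⟫_ℝ :=
    (inner_jac_eq_sum hz a a x).symm
  have h3 : ∑ i, ∑ j, a i * a j * (r * (1 : Matrix (Fin d) (Fin d) ℝ) i j) = r * ‖a‖ ^ 2 := by
    rw [← real_inner_self_eq_norm_sq, inner_eq_sum, Finset.mul_sum]
    refine Finset.sum_congr rfl fun i _ => ?_
    rw [Finset.sum_eq_single i (fun j _ hj => by simp [Matrix.one_apply_ne hj.symm]) (by simp)]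
    simp; ring
  simp only [Matrix.add_apply, symGrad, Matrix.of_apply, Matrix.smul_apply, smul_eq_mul, mul_add,
    Finset.sum_add_distrib]
  rw [h1, h2, h3]; ring

lemma posSemidef_symGrad {z : Torus d → E d} (hz : IsCk 1 z) {L : ℝ≥0}
    (hL : LipschitzWith L fun y : E d => z (proj y)) {r : ℝ} (hr : 2 * L ≤ r) (x : Torus d) :
    (symGrad z x + r • (1 : Matrix (Fin d) (Fin d) ℝ)).PosSemidef := by
  refine Matrix.PosSemidef.of_dotProduct_mulVec_nonneg ?_ fun a => ?_
  · refine Matrix.IsHermitian.add ?_ ?_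
    · ext i j; simp [symGrad, add_comm]
    · ext i j; simp [Matrix.one_apply, eq_comm]
  · have h := sum_mul_symGrad hz r (WithLp.toLp 2 a) x
    have h1 : star a ⬝ᵥ (symGrad z x + r • (1 : Matrix (Fin d) (Fin d) ℝ)).mulVec a =
        ∑ i, ∑ j, a i * a j * (symGrad z x + r • (1 : Matrix (Fin d) (Fin d) ℝ)) i j := by
      simp only [dotProduct, Matrix.mulVec, Finset.mul_sum, Pi.star_apply, star_trivial]
      exact Finset.sum_congr rfl fun i _ => Finset.sum_congr rfl fun j _ => by ring
    rw [h1]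
    simp only at h
    rw [h]
    set b : E d := WithLp.toLp 2 a
    have h2 : -⟪b, jac z x b⟫_ℝ ≤ L * ‖b‖ ^ 2 :=
      calc -⟪b, jac z x b⟫_ℝ ≤ ‖b‖ * ‖jac z x b‖ :=
            (neg_le_abs _).trans (abs_real_inner_le_norm _ _)
        _ ≤ ‖b‖ * (L * ‖b‖) := by gcongr; exact (jac z x).le_of_opNorm_le (norm_jac_le hL x) b
        _ = _ := by ring
    nlinarith [sq_nonneg ‖b‖]

lemma jac_neg (z : Torus d → E d) (x : Torus d) : jac (fun y => -z y) x = -jac z x :=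
  fderiv_fun_neg

lemma div_eq_sum {z : Torus d → E d} (hz : IsCk 1 z) (x : Torus d) :
    div z x = ∑ i, jac z x (EuclideanSpace.single i 1) i := by
  simp only [div, pd_apply hz]

/-- The competitor is `z = -w`; the Lipschitz bound makes the lowest eigenvalue of `∇z + ∇zᵀ` at
least `-2L`. -/
lemma ofReal_le_K {w : Torus d → E d} (hw : IsCk 1 w) (hdw : ∀ x, div w x = 0) {L : ℝ≥0}
    (hL : LipschitzWith L fun y : E d => w (proj y)) {r : ℝ} (hr : 2 * L ≤ r) (B : L2 d) :
    ENNReal.ofReal ((∫ x, (-2 * ⟪B x, jac w x (B x)⟫_ℝ + r * ‖B x‖ ^ 2)) - ∫ x, ‖w x‖ ^ 2)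
      ≤ K r B := by
  have hz : IsCk 1 (fun x => -w x) := ContDiff.neg hw
  have hdz : ∀ x, div (fun x => -w x) x = 0 := fun x => by
    rw [div_eq_sum hz]
    have := hdw x
    rw [div_eq_sum hw] at this
    simp [jac_neg, this]
  have hLz : LipschitzWith L fun y : E d => -w (proj y) := hL.neg
  refine le_trans (le_of_eq ?_) (le_iSup₂_of_le (fun x => -w x) hz (le_iSup₂_of_le hdz
    (fun x => posSemidef_symGrad hz hLz hr x) le_rfl))
  simp only [sum_mul_symGrad hz, jac_neg, neg_apply, inner_neg_right, norm_neg]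
  simp

/-! ### Weak measurability -/

/-- In a separable Hilbert space, weak measurability implies strong measurability. -/
lemma aestronglyMeasurable_of_inner {α H : Type*} [MeasurableSpace α] {μ : Measure α}
    [NormedAddCommGroup H] [InnerProductSpace ℝ H] [CompleteSpace H]
    [SecondCountableTopology H] {f : α → H}
    (hf : ∀ ψ : H, AEStronglyMeasurable (fun t => ⟪ψ, f t⟫_ℝ) μ) : AEStronglyMeasurable f μ := by
  obtain ⟨w, b, -⟩ := exists_hilbertBasis ℝ H
  -- Orthonormal vectors are `√2` apart, so these disjoint balls force the basis of a separable
  -- space to be countable.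
  have hdisj : (univ : Set w).PairwiseDisjoint fun i => Metric.ball (b i) (1 / 2) := by
    intro i _ j _ hij
    refine Metric.ball_disjoint_ball ?_
    have h := norm_sub_sq_real (b i) (b j)
    rw [b.orthonormal.1 i, b.orthonormal.1 j, b.orthonormal.2 hij] at h
    rw [dist_eq_norm]
    nlinarith [norm_nonneg (b i - b j)]
  have hc : (univ : Set w).Countable := hdisj.countable_of_isOpen
    (fun i _ => Metric.isOpen_ball) fun i _ => ⟨b i, Metric.mem_ball_self (by norm_num)⟩
  have : Countable w := countable_univ_iff.1 hc
  refine aestronglyMeasurable_of_tendsto_ae (Filter.atTop : Filter (Finset w))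
    (f := fun s t => ∑ i ∈ s, ⟪b i, f t⟫_ℝ • b i) (fun s => ?_) (.of_forall fun t => ?_)
  · exact Finset.aestronglyMeasurable_fun_sum _ fun i _ => (hf (b i)).smul_const _
  · have := b.hasSum_repr (f t)
    simp only [b.repr_apply_apply] at this
    exact this

/-! ### Time-dependent fields -/

lemma isCk_slice {f : ℝ → Torus d → E d}
    (hf : ContDiffOn ℝ ∞ (fun p : ℝ × E d => f p.1 (proj p.2)) (Icc 0 T ×ˢ univ)) {t : ℝ}
    (ht : t ∈ Icc 0 T) : IsCk ∞ (f t) := by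
  have h : ContDiffOn ℝ ∞ (fun y : E d => f t (proj y)) univ :=
    hf.comp (t := Icc 0 T ×ˢ univ) (f := fun y : E d => (t, y))
      (contDiff_const.prodMk contDiff_id).contDiffOn fun y _ => ⟨ht, trivial⟩
  exact contDiffOn_univ.1 h

lemma continuous_space_time {f : ℝ → Torus d → E d}
    (hf : ContDiffOn ℝ ∞ (fun p : ℝ × E d => f p.1 (proj p.2)) (Icc 0 T ×ˢ univ)) :
    Continuous fun p : Icc 0 T × Torus d => f p.1 p.2 :=
  continuous_uncurry_of_lift (f := fun (s : Icc 0 T) x => f s x) <|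
    hf.continuousOn.comp_continuous (f := fun p : Icc 0 T × E d => ((p.1 : ℝ), p.2))
      (by fun_prop) fun p => ⟨p.1.2, trivial⟩

/-- The spatial differential is the space-time one, taken within the slab, restricted to spatial
directions; unique differentiability of the slab gives continuity up to `t = 0` and `t = T`. -/
lemma continuous_jac_space_time (hT : 0 < T) {f : ℝ → Torus d → E d}
    (hf : ContDiffOn ℝ ∞ (fun p : ℝ × E d => f p.1 (proj p.2)) (Icc 0 T ×ˢ univ)) :
    Continuous fun p : Icc 0 T × Torus d => jac (f p.1) p.2 := by
  refine continuous_uncurry_of_lift (f := fun (s : Icc 0 T) x => jac (f s) x) ?_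
  have hu : UniqueDiffOn ℝ (Icc 0 T ×ˢ (univ : Set (E d))) :=
    (uniqueDiffOn_Icc hT).prod uniqueDiffOn_univ
  have hc := hf.continuousOn_fderivWithin hu (by simp)
  have hc' : Continuous fun p : Icc 0 T × E d => (fderivWithin ℝ
      (fun p : ℝ × E d => f p.1 (proj p.2)) (Icc 0 T ×ˢ univ) (p.1, p.2)).comp
      (ContinuousLinearMap.inr ℝ ℝ (E d)) :=
    (hc.comp_continuous (f := fun p : Icc 0 T × E d => ((p.1 : ℝ), p.2))
      (by fun_prop) fun p => ⟨p.1.2, trivial⟩).clm_comp continuous_const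
  refine hc'.congr fun p => ?_
  rw [jac_proj]
  have h1 := (hf.differentiableOn (by simp) (p.1, p.2) ⟨p.1.2, trivial⟩).hasFDerivWithinAt
  have h2 : HasFDerivAt (fun y : E d => ((p.1 : ℝ), y)) (ContinuousLinearMap.inr ℝ ℝ (E d)) p.2 :=
    hasFDerivAt_prodMk_right _ _
  have h3 := h1.comp (s := univ) p.2 h2.hasFDerivWithinAt fun y _ => ⟨p.1.2, trivial⟩
  exact (hasFDerivWithinAt_univ.1 h3).fderiv.symm

lemma exists_spatiallyLipschitz (hT : 0 < T) {f : ℝ → Torus d → E d}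
    (hf : ContDiffOn ℝ ∞ (fun p : ℝ × E d => f p.1 (proj p.2)) (Icc 0 T ×ˢ univ)) :
    ∃ L : ℝ≥0, SpatiallyLipschitz T L f := by
  obtain ⟨c, hc⟩ := isCompact_univ.exists_bound_of_continuousOn
    (continuous_jac_space_time hT hf).continuousOn
  refine ⟨c.toNNReal, fun t ht => lipschitzWith_of_nnnorm_fderiv_le
    (differentiable_lift ((isCk_slice hf ht).of_le (by simp))) fun y => ?_⟩
  have := hc (⟨t, ht⟩, proj y) trivial
  simp only [jac_proj] at this
  rw [← NNReal.coe_le_coe, coe_nnnorm]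
  exact this.trans (Real.le_coe_toNNReal c)

lemma toLp_eq_toL2 (f : C(Torus d, E d)) :
    ContinuousMap.toLp (E := E d) 2 (volume : Measure (Torus d)) ℝ f = toL2 f := by
  refine Lp.ext ?_
  filter_upwards [ContinuousMap.coeFn_toLp (p := 2) (𝕜 := ℝ) volume f, toL2_coeFn f.continuous]
    with x h1 h2
  rw [h1, h2]

lemma exists_continuous_L2 (hT : 0 < T) {g : ℝ → Torus d → E d}
    (hg : Continuous fun p : Icc 0 T × Torus d => g p.1 p.2) :
    ∃ Y : ℝ → L2 d, Continuous Y ∧ ∀ t ∈ Icc 0 T, Y t = toL2 (g t) := by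
  refine ⟨fun t => ContinuousMap.toLp (E := E d) 2 (volume : Measure (Torus d)) ℝ
    (IccExtend hT.le (ContinuousMap.curry ⟨_, hg⟩) t), (ContinuousLinearMap.continuous _).comp
    (ContinuousMap.continuous _).Icc_extend', fun t ht => ?_⟩
  simp only [toLp_eq_toL2, IccExtend_of_mem _ _ ht]
  rfl

/-- The `L²`-valued path of a time-dependent field that is `C¹` in time, together with its
derivative, extended to all times. -/
lemma exists_L2_path (hT : 0 < T) {g γ : ℝ → Torus d → E d}
    (hg : Continuous fun p : Icc 0 T × Torus d => g p.1 p.2)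
    (hγ : Continuous fun p : Icc 0 T × Torus d => γ p.1 p.2)
    (hd : ∀ t ∈ Icc 0 T, ∀ x, HasDerivWithinAt (fun s => g s x) (γ t x) (Icc 0 T) t) :
    ∃ Y Y' : ℝ → L2 d, Continuous Y' ∧ (∀ t, HasDerivAt Y (Y' t) t) ∧
      ∀ t ∈ Icc 0 T, Y t = toL2 (g t) ∧ Y' t = toL2 (γ t) := by
  have hg' : ∀ t ∈ Icc 0 T, Continuous (g t) := fun t ht =>
    hg.comp (f := fun x => ((⟨t, ht⟩ : Icc 0 T), x)) (by fun_prop)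
  have hγ' : ∀ t ∈ Icc 0 T, Continuous (γ t) := fun t ht =>
    hγ.comp (f := fun x => ((⟨t, ht⟩ : Icc 0 T), x)) (by fun_prop)
  let J := ContinuousMap.toLp (E := E d) 2 (volume : Measure (Torus d)) ℝ
  have hJ : ∀ f : C(Torus d, E d), J f = toL2 f := toLp_eq_toL2
  let Γ : ℝ → C(Torus d, E d) := IccExtend hT.le (ContinuousMap.curry ⟨_, hγ⟩)
  have hΓ : Continuous Γ := (ContinuousMap.continuous _).Icc_extend'
  have hΓt : ∀ t ∈ Icc 0 T, ∀ x, Γ t x = γ t x := fun t ht x => by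
    simp only [Γ, IccExtend_of_mem _ _ ht]; rfl
  have h0 : (0 : ℝ) ∈ Icc 0 T := left_mem_Icc.2 hT.le
  -- Integrating the constantly extended derivative `Γ` gives a path with two-sided derivatives at
  -- every real time; it agrees with `g` on `[0, T]`.
  let Z : ℝ → C(Torus d, E d) := fun t => ⟨g 0, hg' 0 h0⟩ + ∫ s in (0 : ℝ)..t, Γ s
  have hZ : ∀ t, HasDerivAt Z (Γ t) t := fun t =>
    (intervalIntegral.integral_hasDerivAt_right (hΓ.intervalIntegrable _ _)
      (hΓ.stronglyMeasurableAtFilter _ _) hΓ.continuousAt).const_add _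
  have hZt : ∀ t ∈ Icc 0 T, ∀ x, Z t x = g t x := fun t ht x => by
    have h1 : (∫ s in (0 : ℝ)..t, Γ s) x = ∫ s in (0 : ℝ)..t, Γ s x :=
      ((ContinuousMap.evalCLM ℝ x).intervalIntegral_comp_comm (hΓ.intervalIntegrable 0 t)).symm
    have hc : Continuous fun s => Γ s x := (ContinuousMap.evalCLM ℝ x).continuous.comp hΓ
    have h2 : ∫ s in (0 : ℝ)..t, Γ s x = g t x - g 0 x := by
      refine intervalIntegral.integral_eq_sub_of_hasDeriv_right (f := fun s => g s x) ?_ ?_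
        (hc.intervalIntegrable _ _)
      · rw [uIcc_of_le ht.1]
        exact fun s hs => ((hd s ⟨hs.1, hs.2.trans ht.2⟩ x).continuousWithinAt).mono
          (Icc_subset_Icc_right ht.2)
      · rw [min_eq_left ht.1, max_eq_right ht.1]
        intro s hs
        have hsT : s ∈ Icc 0 T := ⟨hs.1.le, hs.2.le.trans ht.2⟩
        rw [hΓt s hsT]
        exact ((hd s hsT x).hasDerivAt
          (Icc_mem_nhds hs.1 (hs.2.trans_le ht.2))).hasDerivWithinAt
    simp only [Z, ContinuousMap.add_apply, ContinuousMap.coe_mk, h1, h2]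
    abel
  refine ⟨fun t => J (Z t), fun t => J (Γ t), J.continuous.comp hΓ,
    fun t => J.hasFDerivAt.comp_hasDerivAt t (hZ t), fun t ht => ⟨?_, ?_⟩⟩
  · simp only [hJ]; congr 1; exact funext (hZt t ht)
  · simp only [hJ]; congr 1; exact funext (hΓt t ht)

/-- A continuous family of matrix fields acts continuously on `L²`. -/
lemma exists_L2_operator (hT : 0 < T) {A : ℝ → Torus d → E d →L[ℝ] E d}
    (hA : Continuous fun p : Icc 0 T × Torus d => A p.1 p.2) :
    ∃ S : ℝ → L2 d →L[ℝ] L2 d, Continuous S ∧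
      ∀ t ∈ Icc 0 T, ∀ b c : L2 d, ⟪b, S t c⟫_ℝ = ∫ x, ⟪b x, A t x (c x)⟫_ℝ := by
  let J := ContinuousMap.toLp (E := E d →L[ℝ] E d) ∞ (volume : Measure (Torus d)) ℝ
  let Γ : ℝ → C(Torus d, E d →L[ℝ] E d) := IccExtend hT.le (ContinuousMap.curry ⟨_, hA⟩)
  have hΓ : Continuous Γ := (ContinuousMap.continuous _).Icc_extend'
  let Bil : (E d →L[ℝ] E d) →L[ℝ] E d →L[ℝ] E d := ContinuousLinearMap.id ℝ _
  refine ⟨fun t => Bil.holderL volume ∞ 2 2 (J (Γ t)),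
    (Bil.holderL volume ∞ 2 2).continuous.comp (J.continuous.comp hΓ), fun t ht b c => ?_⟩
  rw [L2.inner_def]
  refine integral_congr_ae ?_
  rw [ContinuousLinearMap.holderL_apply_apply]
  filter_upwards [Bil.coeFn_holder (r := 2) (J (Γ t)) c,
    ContinuousMap.coeFn_toLp (p := ∞) (𝕜 := ℝ) volume (Γ t)] with x h1 h2
  rw [h1, h2]
  simp only [Γ, IccExtend_of_mem _ _ ht]
  rfl

/-! ### The weak formulation tested with a smooth solution -/

/-- The time derivative of a smooth solution. -/
def timeDeriv (β w : ℝ → Torus d → E d) (t : ℝ) (x : Torus d) : E d :=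
  jac (w t) x (β t x) - jac (β t) x (w t x)

lemma IsSmoothSolution.hasDerivWithinAt {β w : ℝ → Torus d → E d} (h : IsSmoothSolution T β w)
    {t : ℝ} (ht : t ∈ Icc 0 T) (x : Torus d) :
    HasDerivWithinAt (fun s => β s x) (timeDeriv β w t x) (Icc 0 T) t := by
  have hβ : IsCk 1 (β t) := (isCk_slice h.smooth_β ht).of_le (by simp)
  have hw : IsCk 1 (w t) := (isCk_slice h.smooth_w ht).of_le (by simp)
  have := h.transport t ht x
  rw [divTensor_eq hβ hw (h.div_w t ht), divTensor_eq hw hβ (h.div_β t ht), neg_sub] at this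
  exact this

/-- Nothing is known about `β` outside `[0, T]`; the cutoff `χ` vanishes before this matters. -/
lemma IsSmoothSolution.isTest_smul {β w : ℝ → Torus d → E d} (h : IsSmoothSolution T β w)
    {χ : ℝ → ℝ} (hχ : ContDiff ℝ ∞ χ) (hs : ∃ a b, 0 < a ∧ b < T ∧ ∀ t ∉ Icc a b, χ t = 0) :
    IsTest T fun t x => χ t • β t x := by
  obtain ⟨a, b, ha, hb, hab⟩ := hs
  refine ⟨contDiff_iff_contDiffAt.2 fun p => ?_, a, b, ha, hb, fun t ht x => by simp [hab t ht]⟩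
  by_cases hp : p.1 ∈ Icc a b
  · have hn : Icc 0 T ×ˢ (univ : Set (E d)) ∈ nhds p := by
      rw [← Prod.mk.eta (p := p)]
      exact prod_mem_nhds (Icc_mem_nhds (ha.trans_le hp.1) (hp.2.trans_lt hb)) Filter.univ_mem
    exact (hχ.comp contDiff_fst).contDiffAt.smul (h.smooth_β.contDiffAt hn)
  · have : (fun p : ℝ × E d => χ p.1 • β p.1 (proj p.2)) =ᶠ[nhds p] fun _ => 0 := by
      filter_upwards [(isClosed_Icc.isOpen_compl.preimage continuous_fst).mem_nhds hp] with q hq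
      rw [hab q.1 hq, zero_smul]
    exact contDiffAt_const.congr_of_eventuallyEq this

lemma jac_const_smul (c : ℝ) {z : Torus d → E d} (hz : IsCk 1 z) (x : Torus d) :
    jac (fun y => c • z y) x = c • jac z x :=
  fderiv_fun_const_smul (differentiable_lift hz _) c

lemma IsTransported.integral_eq_zero {B v : ℝ → L2 d} (h : IsTransported T B v) (hT : 0 < T)
    {β w : ℝ → Torus d → E d} (hS : IsSmoothSolution T β w) {χ : ℝ → ℝ} (hχ : ContDiff ℝ ∞ χ)
    (hs : ∃ a b, 0 < a ∧ b < T ∧ ∀ t ∉ Icc a b, χ t = 0) :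
    ∫ t in (0 : ℝ)..T, (deriv χ t * ⟪B t, toL2 (β t)⟫_ℝ + χ t * (⟪B t, toL2 (timeDeriv β w t)⟫_ℝ
      + ∫ x, (⟪B t x, jac (β t) x (v t x)⟫_ℝ - ⟪v t x, jac (β t) x (B t x)⟫_ℝ))) = 0 := by
  refine Eq.trans ?_ (h _ (hS.isTest_smul hχ hs))
  refine intervalIntegral.integral_congr_ae ?_
  -- At `t = T` only a one-sided time derivative of `β` is available.
  have hTne : ∀ᵐ t : ℝ, t ≠ T := by simp [ae_iff]
  filter_upwards [hTne] with t htT htm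
  rw [uIoc_of_le hT.le] at htm
  have ht : t ∈ Icc 0 T := ⟨htm.1.le, htm.2⟩
  have hβ : IsCk 1 (β t) := (isCk_slice hS.smooth_β ht).of_le (by simp)
  have hw : IsCk 1 (w t) := (isCk_slice hS.smooth_w ht).of_le (by simp)
  have cβ := continuous_of_isCk hβ
  have cN := continuous_jac hβ
  have cγ : Continuous (timeDeriv β w t) :=
    ((continuous_jac hw).clm_apply cβ).sub (cN.clm_apply (continuous_of_isCk hw))
  have mB : MemLp (B t) 2 (volume : Measure (Torus d)) := Lp.memLp _
  have mv : MemLp (v t) 2 (volume : Measure (Torus d)) := Lp.memLp _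
  have i1 := hasIntegral_of_integrable (integrable_inner mB (memLp_of_continuous cβ))
  have i2 := hasIntegral_of_integrable (integrable_inner mB (memLp_of_continuous cγ))
  have i3 : HasIntegral (fun x => ⟪B t x, jac (β t) x (v t x)⟫_ℝ
      - ⟪v t x, jac (β t) x (B t x)⟫_ℝ) _ :=
    hasIntegral_of_integrable ((integrable_inner mB (memLp_clm cN mv)).sub
      (integrable_inner mv (memLp_clm cN mB)))
  rw [inner_toL2 _ cβ, inner_toL2 _ cγ,
    ← ((i1.const_mul (deriv χ t)).add ((i2.add i3).const_mul (χ t))).2]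
  refine integral_congr_ae (.of_forall fun x => ?_)
  have hz : IsCk 1 fun y => χ t • β t y := ContDiff.const_smul _ hβ
  have e1 : ∑ i, B t x i * deriv (fun s => (χ s • β s x) i) t =
      deriv χ t * ⟪B t x, β t x⟫_ℝ + χ t * ⟪B t x, timeDeriv β w t x⟫_ℝ := by
    have hd : HasDerivAt (fun s => χ s • β s x) (χ t • timeDeriv β w t x + deriv χ t • β t x) t :=
      ((hχ.differentiable (by simp) t).hasDerivAt).smul
        ((hS.hasDerivWithinAt ht x).hasDerivAt (Icc_mem_nhds htm.1 (lt_of_le_of_ne htm.2 htT)))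
    have hdi : ∀ i, deriv (fun s => (χ s • β s x) i) t =
        (χ t • timeDeriv β w t x + deriv χ t • β t x) i := fun i =>
      ((EuclideanSpace.proj i : E d →L[ℝ] ℝ).hasFDerivAt.comp_hasDerivAt t hd).deriv
    simp only [hdi]
    rw [← inner_eq_sum, inner_add_right, inner_smul_right, inner_smul_right]
    ring
  have e2 : ∑ i, ∑ j, (B t x i * v t x j - v t x i * B t x j) *
      pd j (fun y => (χ t • β t y) i) x =
      χ t * (⟪B t x, jac (β t) x (v t x)⟫_ℝ - ⟪v t x, jac (β t) x (B t x)⟫_ℝ) := by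
    have h1 := inner_jac_eq_sum hz (B t x) (v t x) x
    have h2 := inner_jac_eq_sum hz (v t x) (B t x) x
    rw [jac_const_smul _ hβ, smul_apply, inner_smul_right] at h1 h2
    simp only [sub_mul, Finset.sum_sub_distrib]
    rw [← h1, ← h2]; ring
  dsimp only
  rw [e1, e2]; ring

/-! ### Integrals of real functions -/

/-- Truncating at zero only increases the integral, so no sign of `f` is needed. -/
lemma ofReal_integral_le_lintegral {α : Type*} [MeasurableSpace α] {μ : Measure α} {f : α → ℝ}
    (hf : Integrable f μ) : ENNReal.ofReal (∫ x, f x ∂μ) ≤ ∫⁻ x, ENNReal.ofReal (f x) ∂μ := by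
  calc ENNReal.ofReal (∫ x, f x ∂μ) ≤ ENNReal.ofReal (∫ x, max (f x) 0 ∂μ) :=
        ENNReal.ofReal_le_ofReal (integral_mono hf hf.pos_part fun x => le_max_left _ _)
    _ = ∫⁻ x, ENNReal.ofReal (max (f x) 0) ∂μ :=
        ofReal_integral_eq_lintegral_ofReal hf.pos_part (.of_forall fun x => le_max_right _ _)
    _ = _ := by simp [ENNReal.ofReal_max]

/-! ### The stability estimate -/

/-- Pairing a bounded weakly continuous path with a strongly continuous one: `⟪f t, g t - g t₀⟫`
tends to zero by the bound, and `⟪f t, g t₀⟫` converges by weak continuity. -/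
lemma continuousOn_inner_of_weak {H : Type*} [NormedAddCommGroup H] [InnerProductSpace ℝ H]
    {f g : ℝ → H} {s : Set ℝ} {c : ℝ} (hf : ∀ ψ : H, ContinuousOn (fun t => ⟪ψ, f t⟫_ℝ) s)
    (hc : ∀ t ∈ s, ‖f t‖ ≤ c) (hg : ContinuousOn g s) :
    ContinuousOn (fun t => ⟪f t, g t⟫_ℝ) s := by
  intro t₀ ht₀
  have h1 : Filter.Tendsto (fun t => ⟪f t, g t - g t₀⟫_ℝ) (nhdsWithin t₀ s) (nhds 0) := by
    have h2 : Filter.Tendsto (fun t => c * ‖g t - g t₀‖) (nhdsWithin t₀ s) (nhds 0) := by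
      have := ((hg t₀ ht₀).sub (continuousWithinAt_const (b := g t₀))).norm.const_mul c
      simpa [ContinuousWithinAt] using this
    refine squeeze_zero_norm' ?_ h2
    filter_upwards [self_mem_nhdsWithin] with t ht
    exact (norm_inner_le_norm _ _).trans (by gcongr; exact hc t ht)
  have h3 := h1.add (hf (g t₀) t₀ ht₀)
  rw [zero_add] at h3
  have h4 : (fun t => ⟪f t, g t - g t₀⟫_ℝ + ⟪g t₀, f t⟫_ℝ) = fun t => ⟪f t, g t⟫_ℝ := by
    funext t
    rw [inner_sub_right, real_inner_comm (f t)]; ring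
  simp only [h4, real_inner_comm (f t₀)] at h3
  exact h3

/-- Take `r = 0` in the dissipation inequality and drop the integral. -/
lemma IsDissipativeSolution.norm_le {B₀ : L2Div d} {B v : ℝ → L2Div d}
    (h : IsDissipativeSolution T B₀ B v) {t : ℝ} (ht : t ∈ Icc 0 T) : ‖B t‖ ≤ ‖B 0‖ := by
  have h1 := (le_self_add).trans (h.dissipation (fun _ => 0) (fun _ _ => le_rfl)
    intervalIntegrable_const t ht)
  rw [ENNReal.ofReal_le_ofReal_iff (by positivity)] at h1
  simp only [intervalIntegral.integral_zero, Real.exp_zero, mul_one] at h1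
  exact (sq_le_sq₀ (norm_nonneg _) (norm_nonneg _)).1 h1

lemma IsDissipativeSolution.weak_cont_L2 {B₀ : L2Div d} {B v : ℝ → L2Div d}
    (h : IsDissipativeSolution T B₀ B v) (ψ : L2 d) :
    ContinuousOn (fun t => ⟪ψ, (B t : L2 d)⟫_ℝ) (Icc 0 T) := by
  refine (h.weak_cont (leray d ψ)).congr fun t _ => ?_
  rw [real_inner_comm, ← inner_leray, real_inner_comm]

lemma IsDissipativeSolution.memLp_B {B₀ : L2Div d} {B v : ℝ → L2Div d}
    (h : IsDissipativeSolution T B₀ B v) :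
    MemLp (fun t => (B t : L2 d)) 2 (volume.restrict (Icc 0 T)) := by
  have : Fact ((2 : ℝ≥0∞) ≠ ⊤) := ⟨ENNReal.ofNat_ne_top⟩
  refine MemLp.of_bound (aestronglyMeasurable_of_inner fun ψ =>
    (h.weak_cont_L2 ψ).aestronglyMeasurable measurableSet_Icc) ‖B 0‖ ?_
  rw [ae_restrict_iff' measurableSet_Icc]
  exact .of_forall fun t ht => h.norm_le ht

lemma IsDissipativeSolution.memLp_v {B₀ : L2Div d} {B v : ℝ → L2Div d}
    (h : IsDissipativeSolution T B₀ B v) :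
    MemLp (fun t => (v t : L2 d)) 2 (volume.restrict (Icc 0 T)) :=
  (L2Div d).subtypeL.comp_memLp' h.sq_integrable

lemma memLp_of_continuous_time {H : Type*} [NormedAddCommGroup H] {f : ℝ → H}
    (hf : Continuous f) : MemLp f 2 (volume.restrict (Icc 0 T)) := by
  obtain ⟨c, hc⟩ := isCompact_Icc.exists_bound_of_continuousOn (hf.continuousOn (s := Icc 0 T))
  refine MemLp.of_bound hf.aestronglyMeasurable c ?_
  rw [ae_restrict_iff' measurableSet_Icc]
  exact .of_forall hc

/-- `Y`, `Y'`, `W` are paths in `L²` representing `β`, `∂ₜβ`, `w`, and `S` is multiplication by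
`∇β`; they make the time integrands measurable. `F` is `⟪B, β⟫` and `G` its weak derivative. -/
theorem stability (hT : 0 < T) {B₀ : L2Div d} {B v : ℝ → L2Div d}
    (hD : IsDissipativeSolution T B₀ B v) {β w : ℝ → Torus d → E d} (hS : IsSmoothSolution T β w)
    {L : ℝ≥0} (hLβ : SpatiallyLipschitz T L β) (hLw : SpatiallyLipschitz T L w) {t : ℝ}
    (ht : t ∈ Icc 0 T) :
    IntervalIntegrable (fun s => Real.exp ((2 * L + 8 * L ^ 2) * (t - s))
        * (1 / 2 * ‖(v s : L2 d) - toL2 (w s)‖ ^ 2)) volume 0 t ∧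
      ‖(B t : L2 d) - toL2 (β t)‖ ^ 2
        + ∫ s in (0 : ℝ)..t, Real.exp ((2 * L + 8 * L ^ 2) * (t - s))
            * (1 / 2 * ‖(v s : L2 d) - toL2 (w s)‖ ^ 2)
      ≤ ‖(B 0 : L2 d) - toL2 (β 0)‖ ^ 2 * Real.exp ((2 * L + 8 * L ^ 2) * t) := by
  set r : ℝ := 2 * L + 8 * L ^ 2 with hr
  have h0T : (0 : ℝ) ∈ Icc 0 T := left_mem_Icc.2 hT.le
  have hsub : Icc 0 t ⊆ Icc 0 T := Icc_subset_Icc_right ht.2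
  have cβ := continuous_space_time hS.smooth_β
  have cw := continuous_space_time hS.smooth_w
  have cN := continuous_jac_space_time hT hS.smooth_β
  have cM := continuous_jac_space_time hT hS.smooth_w
  have cγ : Continuous fun p : Icc 0 T × Torus d => timeDeriv β w p.1 p.2 :=
    (cM.clm_apply cβ).sub (cN.clm_apply cw)
  obtain ⟨Y, Y', cY', hY, hYeq⟩ := exists_L2_path hT cβ cγ fun t ht x => hS.hasDerivWithinAt ht x
  obtain ⟨W, cW, hW⟩ := exists_continuous_L2 hT cw
  obtain ⟨S, cS, hSop⟩ := exists_L2_operator hT (A := fun s => jac (β s)) cN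
  have cY : Continuous Y := continuous_iff_continuousAt.2 fun t => (hY t).continuousAt
  have mB := hD.memLp_B
  have mv := hD.memLp_v
  obtain ⟨c, hc⟩ := isCompact_Icc.exists_bound_of_continuousOn (cS.continuousOn (s := Icc 0 T))
  have hc' : ∀ᵐ s ∂(volume.restrict (Icc 0 T)), ‖S s‖ ≤ c := by
    rw [ae_restrict_iff' measurableSet_Icc]
    exact .of_forall hc
  have mSv := memLp_clm_of_bound cS.aestronglyMeasurable hc' mv
  have mSB := memLp_clm_of_bound cS.aestronglyMeasurable hc' mB
  set F : ℝ → ℝ := fun s => ⟪(B s : L2 d), Y s⟫_ℝ with hF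
  set G : ℝ → ℝ := fun s => ⟪(B s : L2 d), Y' s⟫_ℝ + (⟪(B s : L2 d), S s (v s)⟫_ℝ
    - ⟪(v s : L2 d), S s (B s)⟫_ℝ) with hG
  have cF : ContinuousOn F (Icc 0 T) :=
    continuousOn_inner_of_weak hD.weak_cont_L2 (fun s hs => hD.norm_le hs) cY.continuousOn
  have huI : uIcc 0 T = Icc 0 T := uIcc_of_le hT.le
  have iG : IntervalIntegrable G volume 0 T := by
    have : IntegrableOn G (Icc 0 T) :=
      (integrable_inner mB (memLp_of_continuous_time cY')).add
        ((integrable_inner mB mSv).sub (integrable_inner mv mSB))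
    exact (intervalIntegrable_iff_integrableOn_Icc_of_le hT.le).2 this
  have hGeq : ∀ s ∈ Icc 0 T, ⟪(B s : L2 d), toL2 (timeDeriv β w s)⟫_ℝ
      + ∫ x, (⟪(B s : L2 d) x, jac (β s) x ((v s : L2 d) x)⟫_ℝ
        - ⟪(v s : L2 d) x, jac (β s) x ((B s : L2 d) x)⟫_ℝ) = G s := fun s hs => by
    have cNs := continuous_jac ((isCk_slice hS.smooth_β hs).of_le (by simp))
    rw [integral_sub (integrable_inner (Lp.memLp _) (memLp_clm cNs (Lp.memLp _)))
      (integrable_inner (Lp.memLp _) (memLp_clm cNs (Lp.memLp _))), ← hSop s hs, ← hSop s hs,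
      ← (hYeq s hs).2]
  have iF : IntervalIntegrable F volume 0 T := (huI ▸ cF).intervalIntegrable
  have cexp : Continuous fun s : ℝ => Real.exp (-r * s) := by fun_prop
  have dexp : ∀ s : ℝ, HasDerivAt (fun s : ℝ => Real.exp (-r * s)) (Real.exp (-r * s) * -r) s :=
    fun s => by simpa using ((hasDerivAt_id s).const_mul (-r)).exp
  have iĜ : IntervalIntegrable (fun s => Real.exp (-r * s) * (G s - r * F s)) volume 0 T :=
    (iG.sub (iF.const_mul r)).continuousOn_mul cexp.continuousOn
  -- The exponential weight is moved onto the test function, so no product rule for the nonsmooth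
  -- `F` is needed.
  have hFG := sub_eq_integral_of_weak_deriv hT (F := fun s => Real.exp (-r * s) * F s)
    (cexp.continuousOn.mul cF) iĜ fun χ hχ hs => by
      have hχ' : ContDiff ℝ ∞ fun s => χ s * Real.exp (-r * s) :=
        hχ.mul (contDiff_const.mul contDiff_id).exp
      have hs' : ∃ a b, 0 < a ∧ b < T ∧ ∀ t ∉ Icc a b, χ t * Real.exp (-r * t) = 0 := by
        obtain ⟨a, b, ha, hb, hab⟩ := hs
        exact ⟨a, b, ha, hb, fun t ht => by rw [hab t ht, zero_mul]⟩
      refine Eq.trans ?_ (hD.transport.integral_eq_zero hT hS hχ' hs')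
      refine intervalIntegral.integral_congr fun s hs => ?_
      rw [huI] at hs
      have hd := ((hχ.differentiable (by simp) s).hasDerivAt.mul (dexp s)).deriv
      simp only [hGeq s hs]
      rw [show deriv (fun s => χ s * Real.exp (-r * s)) s = _ from hd, ← (hYeq s hs).1]
      simp only [hF]
      ring
  have hYY : ∀ s, HasDerivAt (fun s => Real.exp (-r * s) * ‖Y s‖ ^ 2)
      (Real.exp (-r * s) * (2 * ⟪Y s, Y' s⟫_ℝ - r * ‖Y s‖ ^ 2)) s := fun s => by
    refine ((dexp s).mul (hY s).norm_sq).congr_deriv ?_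
    ring
  have cYY : Continuous fun s => Real.exp (-r * s) * (2 * ⟪Y s, Y' s⟫_ℝ - r * ‖Y s‖ ^ 2) :=
    cexp.mul ((continuous_const.mul (cY.inner cY')).sub (continuous_const.mul (cY.norm.pow 2)))
  set f : ℝ → ℝ := fun s => ‖Y s‖ ^ 2 - 2 * F s with hf
  set g : ℝ → ℝ := fun s => 2 * ⟪Y s, Y' s⟫_ℝ - 2 * G s with hg
  have hmono : ∀ {h : ℝ → ℝ}, IntervalIntegrable h volume 0 T → IntervalIntegrable h volume 0 t :=
    fun h => h.mono_set (by rw [uIcc_of_le ht.1, huI]; exact hsub)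
  have igf : IntervalIntegrable (fun s => Real.exp (r * (t - s)) * (g s - r * f s)) volume 0 t := by
    refine IntervalIntegrable.continuousOn_mul (f := fun s => g s - r * f s) ?_
      (by fun_prop : Continuous fun s : ℝ => Real.exp (r * (t - s))).continuousOn
    refine hmono (IntervalIntegrable.sub (.sub ?_ (iG.const_mul 2)) (.const_mul (.sub ?_
      (iF.const_mul 2)) r))
    · exact (continuous_const.mul (cY.inner cY')).intervalIntegrable _ _
    · exact (cY.norm.pow 2).intervalIntegrable _ _
  have hfg : ∫ s in (0 : ℝ)..t, Real.exp (r * (t - s)) * (g s - r * f s) =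
      f t - Real.exp (r * t) * f 0 := by
    have h1 := hFG t ht
    have h2 := intervalIntegral.integral_eq_sub_of_hasDerivAt (fun s _ => hYY s)
      (cYY.intervalIntegrable 0 t)
    have h3 : ∀ s, Real.exp (r * (t - s)) * (g s - r * f s) =
        Real.exp (r * t) * (Real.exp (-r * s) * (2 * ⟪Y s, Y' s⟫_ℝ - r * ‖Y s‖ ^ 2)
          - 2 * (Real.exp (-r * s) * (G s - r * F s))) := fun s => by
      rw [show r * (t - s) = r * t + -r * s by ring, Real.exp_add]
      simp only [hf, hg]; ring
    simp only [h3]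
    rw [intervalIntegral.integral_const_mul, intervalIntegral.integral_sub
      (cYY.intervalIntegrable 0 t) ((hmono iĜ).const_mul 2), intervalIntegral.integral_const_mul,
      h2, ← h1]
    have h4 : Real.exp (r * t) * Real.exp (-r * t) = 1 := by
      rw [← Real.exp_add]; simp
    simp only [hf, mul_zero, Real.exp_zero, one_mul]
    linear_combination (‖Y t‖ ^ 2 - 2 * F t) * h4
  set U : ℝ → ℝ := fun s => 1 / 2 * ‖(v s : L2 d) - W s‖ ^ 2 with hU
  have iU : IntervalIntegrable (fun s => Real.exp (r * (t - s)) * U s) volume 0 t := by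
    refine IntervalIntegrable.continuousOn_mul (f := U) ?_
      (by fun_prop : Continuous fun s : ℝ => Real.exp (r * (t - s))).continuousOn
    refine hmono (IntervalIntegrable.const_mul ?_ _)
    exact (intervalIntegrable_iff_integrableOn_Icc_of_le hT.le).2
      (integrable_norm_sq (mv.sub (memLp_of_continuous_time cW)))
  have hUw : ∀ s ∈ uIcc 0 t, Real.exp (r * (t - s)) * U s =
      Real.exp (r * (t - s)) * (1 / 2 * ‖(v s : L2 d) - toL2 (w s)‖ ^ 2) := fun s hs => by
    rw [uIcc_of_le ht.1] at hs
    simp only [hU, hW s (hsub hs)]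
  refine ⟨iU.congr fun s hs => hUw s (uIoc_subset_uIcc hs), ?_⟩
  rw [← intervalIntegral.integral_congr hUw]
  -- The left side is a real integrable function, so the dissipation integral can be bounded below
  -- without knowing that `K` is measurable in time.
  have hlow : ∀ s ∈ Icc 0 t, ENNReal.ofReal (Real.exp (r * (t - s)) * U s
      + Real.exp (r * (t - s)) * (g s - r * f s)) ≤
      (ENNReal.ofReal (‖v s‖ ^ 2) + K r (B s : L2 d)) *
        ENNReal.ofReal (Real.exp ((∫ _ in (0 : ℝ)..t, r) - ∫ _ in (0 : ℝ)..s, r)) := by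
    intro s hs
    have hsT := hsub hs
    have hβs := isCk_slice hS.smooth_β hsT
    have hws := isCk_slice hS.smooth_w hsT
    have h1 := half_norm_sub_sq_le hβs hws (hS.div_β s hsT) (hLβ s hsT) (hLw s hsT)
      (hS.velocity s hsT) (B s) (v s)
    have h2 := ofReal_le_K (hws.of_le (by simp)) (hS.div_w s hsT) (hLw s hsT)
      (r := r) (by rw [hr]; nlinarith [sq_nonneg (L : ℝ)]) (B s : L2 d)
    have h3 := hGeq s hsT
    rw [show toL2 (fun x => jac (w s) x (β s x) - jac (β s) x (w s x)) = Y' s from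
      (hYeq s hsT).2.symm, ← (hYeq s hsT).1, ← hW s hsT] at h1
    rw [← (hYeq s hsT).2] at h3
    rw [h3, ← hr] at h1
    have h4 : U s + (g s - r * f s) ≤ ‖v s‖ ^ 2 +
        ((∫ x, (-2 * ⟪(B s : L2 d) x, jac (w s) x ((B s : L2 d) x)⟫_ℝ
          + r * ‖(B s : L2 d) x‖ ^ 2)) - ∫ x, ‖w s x‖ ^ 2) := by
      simp only [hU, hg, hf, hF]
      linarith
    have h5 : (∫ _ in (0 : ℝ)..t, r) - ∫ _ in (0 : ℝ)..s, r = r * (t - s) := by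
      simp only [intervalIntegral.integral_const, smul_eq_mul]; ring
    rw [h5, ← mul_add, mul_comm, ENNReal.ofReal_mul' (Real.exp_pos _).le]
    gcongr
    exact (ENNReal.ofReal_le_ofReal h4).trans (ENNReal.ofReal_add_le.trans (by gcongr))
  have hint : IntegrableOn (fun s => Real.exp (r * (t - s)) * U s
      + Real.exp (r * (t - s)) * (g s - r * f s)) (Icc 0 t) :=
    (intervalIntegrable_iff_integrableOn_Icc_of_le ht.1).1 (iU.add igf)
  have hdis := hD.dissipation (fun _ => r) (fun _ _ => by positivity) intervalIntegrable_const t ht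
  have hmain := (add_le_add (le_refl (ENNReal.ofReal (‖B t‖ ^ 2)))
    ((ofReal_integral_le_lintegral hint).trans (setLIntegral_mono' measurableSet_Icc hlow))).trans
      hdis
  have hmain' := ENNReal.ofReal_add_le.trans hmain
  rw [ENNReal.ofReal_le_ofReal_iff (by positivity), integral_Icc_eq_integral_Ioc,
    ← intervalIntegral.integral_of_le ht.1, intervalIntegral.integral_add iU igf, hfg,
    intervalIntegral.integral_const, smul_eq_mul, sub_zero, mul_comm t r] at hmain'
  have e1 := norm_sub_sq_real (B t : L2 d) (Y t)
  have e2 := norm_sub_sq_real (B 0 : L2 d) (Y 0)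
  rw [← (hYeq t ht).1, ← (hYeq 0 h0T).1, e1, e2]
  simp only [hf, hF] at hmain'
  have n1 : ‖(B t : L2 d)‖ = ‖B t‖ := rfl
  have n2 : ‖(B 0 : L2 d)‖ = ‖B 0‖ := rfl
  rw [n1, n2]
  linarith

end MRE

end

/-! ### The main theorem -/

theorem mainTheorem1 :
    ∃ C : ℝ≥0 → ℝ, ∀ (d : ℕ) (T : ℝ), 0 < T →
      ∀ (B₀ : MRE.L2Div d) (B v : ℝ → MRE.L2Div d), MRE.IsDissipativeSolution T B₀ B v →
      ∀ β w : ℝ → MRE.Torus d → MRE.E d, MRE.IsSmoothSolution T β w →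
        (∀ Λ : ℝ≥0, MRE.SpatiallyLipschitz T Λ β → MRE.SpatiallyLipschitz T Λ w →
          ∀ t ∈ Icc 0 T,
            IntervalIntegrable
              (fun s => Real.exp (C Λ * (t - s))
                * (1 / 2 * ‖(v s : MRE.L2 d) - MRE.toL2 (w s)‖ ^ 2)) volume 0 t ∧
            ‖(B t : MRE.L2 d) - MRE.toL2 (β t)‖ ^ 2
              + ∫ s in (0 : ℝ)..t, Real.exp (C Λ * (t - s))
                  * (1 / 2 * ‖(v s : MRE.L2 d) - MRE.toL2 (w s)‖ ^ 2)
            ≤ ‖(B 0 : MRE.L2 d) - MRE.toL2 (β 0)‖ ^ 2 * Real.exp (C Λ * t)) ∧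
        ((B₀ : MRE.L2 d) = MRE.toL2 (β 0) →
          (∀ t ∈ Icc 0 T, (B t : MRE.L2 d) = MRE.toL2 (β t)) ∧
          ∀ᵐ t ∂(volume.restrict (Icc 0 T)), (v t : MRE.L2 d) = MRE.toL2 (w t)) := by
  refine ⟨fun Λ => 2 * Λ + 8 * Λ ^ 2, fun d T hT B₀ B v hD β w hS =>
    ⟨fun Λ hLβ hLw t ht => MRE.stability hT hD hS hLβ hLw ht, fun h0 => ?_⟩⟩
  -- Uniqueness assumes no Lipschitz constant; compactness of `[0, T] × D` provides one.
  obtain ⟨L₁, hL₁⟩ := MRE.exists_spatiallyLipschitz hT hS.smooth_β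
  obtain ⟨L₂, hL₂⟩ := MRE.exists_spatiallyLipschitz hT hS.smooth_w
  have key := fun t (ht : t ∈ Icc 0 T) => MRE.stability hT hD hS (L := max L₁ L₂)
    (fun t ht => (hL₁ t ht).weaken (le_max_left _ _))
    (fun t ht => (hL₂ t ht).weaken (le_max_right _ _)) ht
  rw [hD.initial, h0, sub_self, norm_zero] at key
  generalize ((2 : ℝ) * (max L₁ L₂ : ℝ≥0) + 8 * (max L₁ L₂ : ℝ≥0) ^ 2) = r at key
  have hnn : ∀ t s : ℝ, 0 ≤ Real.exp (r * (t - s)) *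
      (1 / 2 * ‖(v s : MRE.L2 d) - MRE.toL2 (w s)‖ ^ 2) := fun t s => by positivity
  refine ⟨fun t ht => ?_, ?_⟩
  · have h1 := (key t ht).2
    have h2 := intervalIntegral.integral_nonneg (μ := volume) ht.1 fun s _ => hnn t s
    have h3 : ‖(B t : MRE.L2 d) - MRE.toL2 (β t)‖ ^ 2 ≤ 0 := by linarith
    exact sub_eq_zero.1 (norm_eq_zero.1 (pow_eq_zero_iff two_ne_zero |>.1
      (le_antisymm h3 (sq_nonneg _))))
  -- The estimate at the final time alone makes the integral of a nonnegative function zero, hence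
  -- `v = w` almost everywhere.
  · obtain ⟨hi, h1⟩ := key T (right_mem_Icc.2 hT.le)
    have h2 := intervalIntegral.integral_nonneg (μ := volume) hT.le fun s _ => hnn T s
    have h3 := le_antisymm (by nlinarith [sq_nonneg ‖(B T : MRE.L2 d) - MRE.toL2 (β T)‖]) h2
    rw [intervalIntegral.integral_eq_zero_iff_of_le_of_nonneg_ae hT.le
      (.of_forall fun s => hnn T s) hi, restrict_Ioc_eq_restrict_Icc] at h3
    filter_upwards [h3] with s hs
    simpa [sub_eq_zero] using hs
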